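/- **Setting.** Let $\mathrm{UC}$ be the set of upper semicontinuous functions $\mathfrak h:\mathbb R\to[-\infty,\infty)$ with $\mathfrak h\not\equiv-\infty$ and $\limsup_{x\to\pm\infty}\mathfrak h(x)/x^2\le 0$, and let $\mathrm{UC}_c$ be the set of $\mathfrak h\in\mathrm{UC}$ for which there is $L>0$ with $\mathfrak h(x)=-\infty$ for all $|x|>L$. Put $\mathrm{supp}(\mathfrak h)=\overline{\{x:\mathfrak h(x)\neq-\infty\}}$. Let $\mathbf B$ be a two-sided Brownian motion with diffusivity constant $2$ (so that $\mathbf B(t)-\mathbf B(s)$ has variance $2(t-s)$ for $s\le t$); for $a,s\in\mathbb R$, $\mathbb E_{\mathbf B(a)=s}$ denotes expectation for the two-sided Brownian motion that takes the value $s$ at time $a$. For $a\in\mathbb R$ put $$\tau_+^a=\inf\{\alpha\ge a:\mathbf B(\alpha)\le\mathfrak h(\alpha)\},\qquad \tau_-^a=\sup\{\alpha\le a:\mathbf B(\alpha)\le\mathfrak h(\alpha)\},$$ with $\inf\emptyset=+\infty$ and $\sup\emptyset=-\infty$. For $\mathfrak h\in\mathrm{UC}_c$ and $\eta,\xi\in\mathbb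 C$ with $\mathrm{Re}\,\eta>0$ and $\mathrm{Re}\,\xi<0$, define $$\begin{aligned}\chi_{\mathfrak h}(\eta,\xi)={}&\int_{\mathbb R}e^{s\eta}\,\mathbb E_{\mathbf B(0)=s}\big[e^{-\tau_+^0\xi^2-\mathbf B(\tau_+^0)\xi}\mathbf 1_{\tau_+^0<\infty}\big]ds+\int_{\mathbb R}e^{-s\xi}\,\mathbb E_{\mathbf B(0)=s}\big[e^{\tau_-^0\eta^2+\mathbf B(\tau_-^0)\eta}\mathbf 1_{\tau_-^0>-\infty}\big]ds\\&-\int_{\mathbb R}\mathbb E_{\mathbf B(0)=s}\big[e^{-\tau_+^0\xi^2-\mathbf B(\tau_+^0)\xi}\mathbf 1_{\tau_+^0<\infty}\big]\,\mathbb E_{\mathbf B(0)=s}\big[e^{\tau_-^0\eta^2+\mathbf B(\tau_-^0)\eta}\mathbf 1_{\tau_-^0>-\infty}\big]ds.\end{aligned}$$ **Proposition.** Let $\mathfrak h\in\mathrm{UC}_c$, $\mathrm{Re}\,\eta>0$ and $\mathrm{Re}\,\xi<0$. (i) For every $a\in\mathbb R$, $$\begin{aligned}\chi_{\mathfrak h}(\eta,\xi)={}&e^{a\eta^2}\int_{\mathbb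 R}e^{s\eta}\,\mathbb E_{\mathbf B(a)=s}\big[e^{-\tau_+^a\xi^2-\mathbf B(\tau_+^a)\xi}\mathbf 1_{\tau_+^a<\infty}\big]ds+e^{-a\xi^2}\int_{\mathbb R}e^{-s\xi}\,\mathbb E_{\mathbf B(a)=s}\big[e^{\tau_-^a\eta^2+\mathbf B(\tau_-^a)\eta}\mathbf 1_{\tau_-^a>-\infty}\big]ds\\&-\int_{\mathbb R}\mathbb E_{\mathbf B(a)=s}\big[e^{\tau_-^a\eta^2+\mathbf B(\tau_-^a)\eta-\tau_+^a\xi^2-\mathbf B(\tau_+^a)\xi}\mathbf 1_{\tau_+^a<\infty,\ \tau_-^a>-\infty}\big]ds.\end{aligned}$$ (ii) In particular, if $L>0$ and $\mathrm{supp}(\mathfrak h)\subset[-L,L]$, then $$\chi_{\mathfrak h}(\eta,\xi)=e^{-L\eta^2}\int_{\mathbb R}e^{s\eta}\,\mathbb E_{\mathbf B(-L)=s}\big[e^{-\tau_+^{-L}\xi^2-\mathbf B(\tau_+^{-L})\xi}\mathbf 1_{\tau_+^{-L}\le L}\big]ds.$$ In (i) and (ii), the random variables on the right-hand sides are integrable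 for every $s$, and the integrals over $s$ converge absolutely. -/

import Mathlib

open MeasureTheory ProbabilityTheory

/-- Upper semicontinuous functions `𝔥 : ℝ → [-∞, ∞)`, not identically `-∞`, such that
`limsup 𝔥(x) / x² ≤ 0` as `x → ±∞`. -/
def UC : Set (ℝ → EReal) :=
  {h | UpperSemicontinuous h ∧ (∀ x, h x ≠ ⊤) ∧ (∃ x, h x ≠ ⊥) ∧
    Filter.limsup (fun x : ℝ => h x / ((x ^ 2 : ℝ) : EReal)) Filter.atTop ≤ 0 ∧
    Filter.limsup (fun x : ℝ => h x / ((x ^ 2 : ℝ) : EReal)) Filter.atBot ≤ 0}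

/-- The functions in `UC` that are `-∞` outside a bounded interval. -/
def UCc : Set (ℝ → EReal) :=
  {h | h ∈ UC ∧ ∃ L : ℝ, 0 < L ∧ ∀ x : ℝ, L < |x| → h x = ⊥}

/-- The support of `𝔥`: the closure of the set where `𝔥 ≠ -∞`. -/
def hSupport (h : ℝ → EReal) : Set ℝ := closure {x | h x ≠ ⊥}

/-- `W` is a two-sided Brownian motion with diffusivity constant `2`, normalised by `W 0 = 0`:
independent increments, `W t - W s` centred Gaussian of variance `2 (t - s)` for `s ≤ t`, and
almost surely continuous paths. -/
structure IsTwoSidedBrownian {Ω : Type*} [MeasurableSpace Ω] (W : ℝ → Ω → ℝ) (P : Measure Ω) :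
    Prop where
  zero : ∀ᵐ ω ∂P, W 0 ω = 0
  indep : HasIndepIncrements W P
  law : ∀ s t : ℝ, s ≤ t → HasLaw (W t - W s) (gaussianReal 0 (Real.toNNReal (2 * (t - s)))) P
  cont : ∀ᵐ ω ∂P, Continuous fun t => W t ω

/-- The two-sided Brownian path `B` with `B(a) = s`. -/
def pathFrom {Ω : Type*} (W : ℝ → Ω → ℝ) (a s : ℝ) (ω : Ω) : ℝ → ℝ :=
  fun t => s + (W t ω - W a ω)

/-- The expectation `𝔼_{B(a) = s}[F(B)]`. -/
noncomputable def expFrom {Ω : Type*} [MeasurableSpace Ω] (W : ℝ → Ω → ℝ) (P : Measure Ω)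
    (a s : ℝ) (F : (ℝ → ℝ) → ℂ) : ℂ :=
  ∫ ω, F (pathFrom W a s ω) ∂P

/-- `τ₊ = inf {α ≥ a : b(α) ≤ 𝔥(α)}`, with `inf ∅ = +∞`. -/
noncomputable def tauPlus (h : ℝ → EReal) (a : ℝ) (b : ℝ → ℝ) : EReal :=
  sInf ((fun t : ℝ => (t : EReal)) '' {t : ℝ | a ≤ t ∧ (b t : EReal) ≤ h t})

/-- `τ₋ = sup {α ≤ a : b(α) ≤ 𝔥(α)}`, with `sup ∅ = -∞`. -/
noncomputable def tauMinus (h : ℝ → EReal) (a : ℝ) (b : ℝ → ℝ) : EReal :=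
  sSup ((fun t : ℝ => (t : EReal)) '' {t : ℝ | t ≤ a ∧ (b t : EReal) ≤ h t})

/-- `exp(-τ₊ ξ² - b(τ₊) ξ) 1_{τ₊ < ∞}`. -/
noncomputable def weightPlus (h : ℝ → EReal) (ξ : ℂ) (a : ℝ) (b : ℝ → ℝ) : ℂ :=
  if tauPlus h a b < ⊤ then
    Complex.exp (-((tauPlus h a b).toReal : ℂ) * ξ ^ 2 - (b (tauPlus h a b).toReal : ℂ) * ξ)
  else 0

/-- `exp(τ₋ η² + b(τ₋) η) 1_{τ₋ > -∞}`. -/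
noncomputable def weightMinus (h : ℝ → EReal) (η : ℂ) (a : ℝ) (b : ℝ → ℝ) : ℂ :=
  if ⊥ < tauMinus h a b then
    Complex.exp (((tauMinus h a b).toReal : ℂ) * η ^ 2 + (b (tauMinus h a b).toReal : ℂ) * η)
  else 0

/-- `exp(τ₋ η² + b(τ₋) η - τ₊ ξ² - b(τ₊) ξ) 1_{|τ₊|, |τ₋| < ∞}`. -/
noncomputable def weightBoth (h : ℝ → EReal) (η ξ : ℂ) (a : ℝ) (b : ℝ → ℝ) : ℂ :=
  if tauPlus h a b < ⊤ ∧ ⊥ < tauMinus h a b then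
    Complex.exp (((tauMinus h a b).toReal : ℂ) * η ^ 2 + (b (tauMinus h a b).toReal : ℂ) * η
      - ((tauPlus h a b).toReal : ℂ) * ξ ^ 2 - (b (tauPlus h a b).toReal : ℂ) * ξ)
  else 0

/-- `exp(-τ₊ ξ² - b(τ₊) ξ) 1_{τ₊ ≤ L}`. -/
noncomputable def weightPlusLe (h : ℝ → EReal) (ξ : ℂ) (L a : ℝ) (b : ℝ → ℝ) : ℂ :=
  if tauPlus h a b ≤ (L : EReal) then
    Complex.exp (-((tauPlus h a b).toReal : ℂ) * ξ ^ 2 - (b (tauPlus h a b).toReal : ℂ) * ξ)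
  else 0

/-- The characteristic function `χ_𝔥(η, ξ)`, with Brownian motion started at the origin. -/
noncomputable def chi {Ω : Type*} [MeasurableSpace Ω] (W : ℝ → Ω → ℝ) (P : Measure Ω)
    (h : ℝ → EReal) (η ξ : ℂ) : ℂ :=
  (∫ s : ℝ, Complex.exp ((s : ℂ) * η) * expFrom W P 0 s (weightPlus h ξ 0))
  + (∫ s : ℝ, Complex.exp (-(s : ℂ) * ξ) * expFrom W P 0 s (weightMinus h η 0))
  - ∫ s : ℝ, expFrom W P 0 s (weightPlus h ξ 0) * expFrom W P 0 s (weightMinus h η 0)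

/-!
Fix `T` so large that the barrier is `-∞` outside `[-T, T]` and `|a| < T`, and give the value of the
path `B` at time `a` Lebesgue measure. By translation invariance of Lebesgue measure the resulting
infinite measure `μ` on paths does not depend on `a` (`measurePreserving_recenter`). Put
`Z = exp (-T η² + B(-T) η) exp (-T ξ² - B(T) ξ)` (`endWeight`).

The processes `exp (-t ξ² - B(t) ξ)`, `t ≥ a`, and `exp (t η² + B(t) η)`, `t ≤ a` run backwards, are
martingales. Optional stopping at the first hit after `a`, respectively at the last hit before `a`
(`integrable_stopWeight_and_integral_eq`), together with the independence of the past and the future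
of `a` (`indep_past_future`), turns the three terms of the formula into integrals of `Z` against `μ`
over the events of a hit in `[a, T]`, in `[-T, a]`, and in both (`integral_hitOn_right`,
`integral_hitOn_left`, `integral_hitOn_inter`). By inclusion–exclusion the total is the integral of
`Z` over the event of a hit in `[-T, T]`, in which `a` no longer occurs (`chi_terms_eq`). For `a = 0`
it is `chi`, since the expectation of the two-sided weight factorizes. If the barrier is `-∞` before
`a`, hits in `[-T, T]` are hits in `[a, T]`, and the first term alone has this value
(`first_term_eq`).

The analytic input is that the running maximum of `|B|` over a bounded time interval has all
exponential moments (`exists_bound`), which follows from the maximal inequality for the exponential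
martingale. It dominates the discretized stopping times in the optional stopping argument, and it
makes `Z` integrable over the event of a hit: a path that hits the barrier, which is bounded above,
starts at most the range of the path above it, and for low starting points `Z` decays like
`exp (s Re (η - ξ))`.

All of this is carried out for a version of the Brownian motion whose paths are all continuous
(`exists_regular`).
-/

/-! ### Hitting sets of an upper semicontinuous barrier -/

theorem isClosed_setOf_coe_le {g : ℝ → EReal} (hg : UpperSemicontinuous g) {b : ℝ → ℝ}
    (hb : Continuous b) : IsClosed {t : ℝ | (b t : EReal) ≤ g t} := by
  rw [← isOpen_compl_iff, isOpen_iff_mem_nhds]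
  intro t ht
  simp only [Set.mem_compl_iff, Set.mem_ofPred_eq, not_le] at ht
  obtain ⟨y, hy1, hy2⟩ := EReal.lt_iff_exists_real_btwn.1 ht
  have h1 := hg t y hy1
  have h2 : ∀ᶠ r in nhds t, y < b r :=
    hb.continuousAt.eventually (lt_mem_nhds (EReal.coe_lt_coe_iff.1 hy2))
  filter_upwards [h1, h2] with r hr1 hr2
  simp only [Set.mem_compl_iff, Set.mem_ofPred_eq, not_le]
  exact hr1.trans (EReal.coe_lt_coe_iff.2 hr2)

/-- A continuous random path meets the hypograph of an upper semicontinuous function during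
`[c, d]` iff, for every `n`, at some time of a countable dense set it lies at most `1 / (n + 1)`
above a value of the function at distance at most `1 / (n + 1)`; this makes the event measurable
for the σ-algebra generated by the path on `[c, d]`. -/
theorem measurableSet_hit {T : Type*} {m : MeasurableSpace T} {g : ℝ → EReal}
    (hg : UpperSemicontinuous g) {c d : ℝ} {Y : ℝ → T → ℝ}
    (hY : ∀ r ∈ Set.Icc c d, Measurable (Y r)) (hc : ∀ x, Continuous fun r => Y r x) :
    MeasurableSet {x | ∃ r ∈ Set.Icc c d, (Y r x : EReal) ≤ g r} := by
  rcases lt_or_ge d c with hcd | hcd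
  · simp [Set.Icc_eq_empty_of_lt hcd]
  have : Nonempty (Set.Icc c d) := ⟨⟨c, le_refl c, hcd⟩⟩
  let q : ℕ → Set.Icc c d := TopologicalSpace.denseSeq (Set.Icc c d)
  have hq : DenseRange q := TopologicalSpace.denseRange_denseSeq _
  let ε : ℕ → ℝ := fun n => 1 / ((n : ℝ) + 1)
  have hε : ∀ n, 0 < ε n := fun n => by positivity
  have hε0 : Filter.Tendsto ε Filter.atTop (nhds 0) := tendsto_one_div_add_atTop_nhds_zero_nat
  have key : {x | ∃ r ∈ Set.Icc c d, (Y r x : EReal) ≤ g r} =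
      ⋂ n : ℕ, ⋃ k : ℕ, Y (q k) ⁻¹'
        {y : ℝ | ∃ r ∈ Set.Icc c d, |r - q k| ≤ ε n ∧ ((y - ε n : ℝ) : EReal) ≤ g r} := by
    ext x
    simp only [Set.mem_ofPred_eq, Set.mem_iInter, Set.mem_iUnion, Set.mem_preimage]
    constructor
    · rintro ⟨r, hr, hle⟩ n
      have hopen : IsOpen {p : Set.Icc c d | |r - p| < ε n ∧ Y p x < Y r x + ε n} := by
        apply IsOpen.inter
        · exact isOpen_lt (continuous_const.sub continuous_subtype_val).abs continuous_const
        · exact isOpen_lt ((hc x).comp continuous_subtype_val) continuous_const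
      obtain ⟨k, hk1, hk2⟩ := hq.exists_mem_open hopen ⟨⟨r, hr⟩, by simp [hε n], by simp [hε n]⟩
      refine ⟨k, r, hr, hk1.le, le_trans (EReal.coe_le_coe_iff.2 ?_) hle⟩
      linarith
    · intro H
      choose k r hr hrk hle using H
      obtain ⟨t, ht, φ, hφ, hlim⟩ := isCompact_Icc.tendsto_subseq hr
      refine ⟨t, ht, ?_⟩
      by_contra hlt
      obtain ⟨y, hy1, hy2⟩ := EReal.lt_iff_exists_real_btwn.1 (not_le.1 hlt)
      have e0 : Filter.Tendsto (fun n => ε (φ n)) Filter.atTop (nhds 0) :=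
        hε0.comp hφ.tendsto_atTop
      have e1 : Filter.Tendsto (fun n => r (φ n) - q (k (φ n))) Filter.atTop (nhds 0) :=
        squeeze_zero_norm (fun n => hrk (φ n)) e0
      have e2 : Filter.Tendsto (fun n => (q (k (φ n)) : ℝ)) Filter.atTop (nhds t) := by
        simpa using Filter.Tendsto.sub hlim e1
      have e3 : Filter.Tendsto (fun n => Y (q (k (φ n))) x - ε (φ n)) Filter.atTop
          (nhds (Y t x)) := by
        simpa using (((hc x).tendsto t).comp e2).sub e0
      obtain ⟨n, hn1, hn2⟩ := ((hlim.eventually (hg t y hy1)).and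
        (e3.eventually (lt_mem_nhds (EReal.coe_lt_coe_iff.1 hy2)))).exists
      exact absurd ((hle (φ n)).trans hn1.le) (not_le.2 (EReal.coe_lt_coe_iff.2 hn2))
  rw [key]
  refine MeasurableSet.iInter fun n => MeasurableSet.iUnion fun k => hY _ (q k).2 ?_
  apply Set.OrdConnected.measurableSet
  apply IsLowerSet.ordConnected
  rintro y z hzy ⟨r, hr, hr1, hr2⟩
  refine ⟨r, hr, hr1, le_trans (EReal.coe_le_coe_iff.2 ?_) hr2⟩
  linarith

/-! ### One-sided Brownian motion and the exponential martingale -/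

section

variable {Ω : Type*} [MeasurableSpace Ω] {P : Measure Ω}

/-- `X` is a one-sided Brownian motion with diffusivity constant `2` started at `0`, all of whose
paths are continuous. The time index is `ℝ`, but only the restriction to `[0, ∞)` is constrained
(apart from continuity and measurability); the increment after `t` is independent of the path on
`[0, t]`. -/
structure IsOneSidedBrownian (X : ℝ → Ω → ℝ) (P : Measure Ω) : Prop where
  zero : ∀ ω, X 0 ω = 0
  cont : ∀ ω, Continuous fun t => X t ω
  meas : ∀ t, Measurable (X t)
  law : ∀ s t : ℝ, 0 ≤ s → s ≤ t →
    HasLaw (fun ω => X t ω - X s ω) (gaussianReal 0 (Real.toNNReal (2 * (t - s)))) P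
  indep : ∀ s t : ℝ, 0 ≤ s → s ≤ t →
    IndepFun (fun ω (r : Set.Icc 0 s) => X r ω) (fun ω => X t ω - X s ω) P

/-- The σ-algebra generated by the path of `X` on `[0, t]`. -/
abbrev pathSigma {Ω : Type*} (X : ℝ → Ω → ℝ) (t : ℝ) : MeasurableSpace Ω :=
  MeasurableSpace.comap (fun ω (r : Set.Icc 0 t) => X r ω) MeasurableSpace.pi

theorem measurable_pathSigma {Ω : Type*} (X : ℝ → Ω → ℝ) {r t : ℝ} (hr : 0 ≤ r) (hrt : r ≤ t) :
    Measurable[pathSigma X t] (X r) :=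
  (measurable_pi_apply (⟨r, hr, hrt⟩ : Set.Icc 0 t)).comp
    (comap_measurable (fun ω (r : Set.Icc 0 t) => X r ω))

/-- The exponential functional `exp (-t ξ² - (s + X t) ξ)` of the path started at `s`; it is a
martingale in `t`. -/
noncomputable def expMart (X : ℝ → Ω → ℝ) (ξ : ℂ) (s t : ℝ) (ω : Ω) : ℂ :=
  Complex.exp (-(t : ℂ) * ξ ^ 2 - ((s + X t ω : ℝ) : ℂ) * ξ)

namespace IsOneSidedBrownian

variable {X : ℝ → Ω → ℝ}

theorem pathSigma_le (hX : IsOneSidedBrownian X P) (t : ℝ) :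
    pathSigma X t ≤ ‹MeasurableSpace Ω› :=
  (measurable_pi_lambda (fun ω (r : Set.Icc 0 t) => X r ω) fun r => hX.meas r).comap_le

theorem measurable_expMart (hX : IsOneSidedBrownian X P) (ξ : ℂ) (s t : ℝ) :
    Measurable (expMart X ξ s t) := by
  have := hX.meas t
  unfold expMart
  fun_prop

/-- The complex exponential moment of an increment. -/
theorem integral_exp_increment (hX : IsOneSidedBrownian X P) (ξ : ℂ) {t u : ℝ} (ht : 0 ≤ t)
    (htu : t ≤ u) :
    ∫ ω, Complex.exp (-((X u ω - X t ω : ℝ) : ℂ) * ξ) ∂P = Complex.exp ((u - t) * ξ ^ 2) := by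
  have h := complexMGF_gaussianReal (hX.law t u ht htu).map_eq (-ξ)
  have h2 : ((Real.toNNReal (2 * (u - t)) : NNReal) : ℂ) = 2 * (u - t) := by
    have : ((Real.toNNReal (2 * (u - t)) : NNReal) : ℝ) = 2 * (u - t) :=
      Real.coe_toNNReal _ (by linarith)
    exact_mod_cast congrArg (fun x : ℝ => (x : ℂ)) this
  rw [h2] at h
  rw [complexMGF] at h
  convert h using 2
  · ext ω
    congr 1
    ring
  · push_cast
    ring

/-- The martingale property of `expMart`, integrated over an event known at time `t`. -/
theorem integral_indicator_expMart (hX : IsOneSidedBrownian X P) (ξ : ℂ) (s : ℝ) {t u : ℝ}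
    (ht : 0 ≤ t) (htu : t ≤ u) {A : Set Ω} (hA : MeasurableSet[pathSigma X t] A) :
    ∫ ω, A.indicator (expMart X ξ s u) ω ∂P = ∫ ω, A.indicator (expMart X ξ s t) ω ∂P := by
  have hsplit : ∀ ω, A.indicator (expMart X ξ s u) ω =
      (Complex.exp (-((u : ℂ) - t) * ξ ^ 2) * A.indicator (expMart X ξ s t) ω) *
        Complex.exp (-((X u ω - X t ω : ℝ) : ℂ) * ξ) := by
    intro ω
    by_cases hω : ω ∈ A
    · simp only [Set.indicator_of_mem hω, expMart]
      rw [← Complex.exp_add, ← Complex.exp_add]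
      congr 1
      push_cast
      ring
    · simp [Set.indicator_of_notMem hω]
  have hmX : Measurable[pathSigma X t] (X t) := measurable_pathSigma X ht le_rfl
  have hm1 : Measurable[pathSigma X t]
      (fun ω => Complex.exp (-((u : ℂ) - t) * ξ ^ 2) * A.indicator (expMart X ξ s t) ω) := by
    refine Measurable.const_mul (Measurable.indicator ?_ hA) _
    unfold expMart
    fun_prop
  have hind : IndepFun
      (fun ω => Complex.exp (-((u : ℂ) - t) * ξ ^ 2) * A.indicator (expMart X ξ s t) ω)
      (fun ω => Complex.exp (-((X u ω - X t ω : ℝ) : ℂ) * ξ)) P := by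
    have h0 := hX.indep t u ht htu
    rw [IndepFun_iff_Indep] at h0 ⊢
    refine indep_of_indep_of_le_left (indep_of_indep_of_le_right h0 ?_) hm1.comap_le
    have : Measurable[MeasurableSpace.comap (fun ω => X u ω - X t ω) inferInstance]
      (fun ω => X u ω - X t ω) := comap_measurable _
    apply Measurable.comap_le
    fun_prop
  have hmu := hX.meas u
  have hmt := hX.meas t
  simp_rw [hsplit]
  rw [hind.integral_fun_mul_eq_mul_integral
      (hm1.mono (hX.pathSigma_le t) le_rfl).aestronglyMeasurable
      (by fun_prop : Measurable _).aestronglyMeasurable,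
    hX.integral_exp_increment ξ ht htu, integral_const_mul, mul_right_comm, ← Complex.exp_add,
    ← add_mul, neg_add_cancel, zero_mul, Complex.exp_zero, one_mul]

theorem integral_expMart [IsProbabilityMeasure P] (hX : IsOneSidedBrownian X P) (ξ : ℂ) (s : ℝ)
    {u : ℝ} (hu : 0 ≤ u) : ∫ ω, expMart X ξ s u ω ∂P = Complex.exp (-(s : ℂ) * ξ) := by
  have := hX.integral_indicator_expMart ξ s le_rfl hu (A := Set.univ) MeasurableSet.univ
  simpa [expMart, hX.zero] using this

end IsOneSidedBrownian

end

/-! ### Exponential moments of the running maximum -/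

section

variable {Ω : Type*} [MeasurableSpace Ω] {P : Measure Ω}

namespace IsOneSidedBrownian

variable {X : ℝ → Ω → ℝ}

theorem integrable_exp_mul (hX : IsOneSidedBrownian X P) (c : ℝ) {t : ℝ} (ht : 0 ≤ t) :
    Integrable (fun ω => Real.exp (c * X t ω)) P := by
  have hl := hX.law 0 t le_rfl ht
  have h := integrable_exp_mul_gaussianReal (μ := 0) (v := Real.toNNReal (2 * (t - 0))) c
  rw [← hl.map_eq] at h
  have h2 := (integrable_map_measure h.aestronglyMeasurable hl.aemeasurable).1 h
  refine h2.congr (Filter.Eventually.of_forall fun ω => ?_)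
  simp [hX.zero ω]

/-- The real-valued exponential martingale. -/
theorem setIntegral_exp_mul (hX : IsOneSidedBrownian X P) (c : ℝ) {t u : ℝ}
    (ht : 0 ≤ t) (htu : t ≤ u) {A : Set Ω} (hA : MeasurableSet[pathSigma X t] A) :
    ∫ ω in A, Real.exp (-u * c ^ 2 + c * X u ω) ∂P =
      ∫ ω in A, Real.exp (-t * c ^ 2 + c * X t ω) ∂P := by
  have h := hX.integral_indicator_expMart (-(c : ℂ)) 0 ht htu hA
  have hA' := hX.pathSigma_le t A hA
  rw [integral_indicator hA', integral_indicator hA'] at h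
  have hre : ∀ r : ℝ, expMart X (-(c : ℂ)) 0 r =
      fun ω => ((Real.exp (-r * c ^ 2 + c * X r ω) : ℝ) : ℂ) := by
    intro r
    ext ω
    simp only [expMart]
    push_cast
    congr 1
    ring
  simp only [hre, integral_complex_ofReal] at h
  exact_mod_cast h

/-- The maximal inequality for the exponential martingale along a finite set of times. -/
theorem measureReal_exists_le [IsProbabilityMeasure P] (hX : IsOneSidedBrownian X P) (c y : ℝ)
    {u : ℝ} (F : Finset ℝ) (hF : ∀ r ∈ F, 0 ≤ r ∧ r ≤ u) (hu : 0 ≤ u) :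
    P.real {ω | ∃ r ∈ F, y ≤ c * X r ω} ≤ Real.exp (-y + c ^ 2 * u) := by
  -- `A r` is the event that `r` is the first time of `F` at which `c X` is at least `y`.
  let A : ℝ → Set Ω := fun r => {ω | y ≤ c * X r ω} ∩ ⋂ r' ∈ F.filter (· < r), {ω | c * X r' ω < y}
  have hAm : ∀ r ∈ F, MeasurableSet[pathSigma X r] (A r) := by
    intro r hr
    refine MeasurableSet.inter ?_ (Finset.measurableSet_biInter _ fun r' hr' => ?_)
    · exact measurableSet_le measurable_const
        ((measurable_pathSigma X (hF r hr).1 le_rfl).const_mul c)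
    · rw [Finset.mem_filter] at hr'
      exact measurableSet_lt
        ((measurable_pathSigma X (hF r' hr'.1).1 hr'.2.le).const_mul c) measurable_const
  have hAm' : ∀ r ∈ F, MeasurableSet (A r) := fun r hr => hX.pathSigma_le r _ (hAm r hr)
  have hdisj : Set.Pairwise (↑F) (Function.onFun Disjoint A) := by
    have aux : ∀ r ∈ F, ∀ r', r < r' → Disjoint (A r) (A r') := by
      intro r hr r' hlt
      rw [Set.disjoint_left]
      rintro ω ⟨h1, -⟩ ⟨-, h2⟩
      simp only [Set.mem_iInter, Finset.mem_filter] at h2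
      exact absurd (show y ≤ c * X r ω from h1) (not_le.2 (h2 r ⟨hr, hlt⟩))
    intro r hr r' hr' hne
    rcases lt_or_gt_of_ne hne with h | h
    · exact aux r hr r' h
    · exact (aux r' hr' r h).symm
  have hU : {ω | ∃ r ∈ F, y ≤ c * X r ω} = ⋃ r ∈ F, A r := by
    ext ω
    simp only [Set.mem_ofPred_eq, Set.mem_iUnion, exists_prop]
    constructor
    · rintro ⟨r, hr, hle⟩
      obtain ⟨m, hm, hmin⟩ := (F.filter (fun r => y ≤ c * X r ω)).exists_minimal
        ⟨r, by simp [hr, hle]⟩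
      rw [Finset.mem_filter] at hm
      refine ⟨m, hm.1, hm.2, ?_⟩
      simp only [Set.mem_iInter, Finset.mem_filter, Set.mem_ofPred_eq]
      rintro r' ⟨hr', hlt⟩
      by_contra hcon
      have := hmin (Finset.mem_filter.2 ⟨hr', not_lt.1 hcon⟩) hlt.le
      linarith
    · rintro ⟨r, hr, hω⟩
      exact ⟨r, hr, hω.1⟩
  have hint : ∀ r, 0 ≤ r → Integrable (fun ω => Real.exp (-r * c ^ 2 + c * X r ω)) P := by
    intro r hr
    simp_rw [Real.exp_add]
    exact (hX.integrable_exp_mul c hr).const_mul _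
  -- The path starts at `0`, so the martingale has mean `1`.
  have hone : ∫ ω, Real.exp (-u * c ^ 2 + c * X u ω) ∂P = 1 := by
    have := hX.setIntegral_exp_mul c le_rfl hu (A := Set.univ) MeasurableSet.univ
    simpa [hX.zero] using this
  have hle : ∀ r ∈ F, Real.exp (y - c ^ 2 * u) * P.real (A r) ≤
      ∫ ω in A r, Real.exp (-u * c ^ 2 + c * X u ω) ∂P := by
    intro r hr
    rw [hX.setIntegral_exp_mul c (hF r hr).1 (hF r hr).2 (hAm r hr)]
    have : Real.exp (y - c ^ 2 * u) * P.real (A r) =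
        ∫ ω in A r, Real.exp (y - c ^ 2 * u) ∂P := by
      rw [setIntegral_const, smul_eq_mul, mul_comm]
    rw [this]
    refine setIntegral_mono_on (integrable_const _).integrableOn
      (hint r (hF r hr).1).integrableOn (hAm' r hr) fun ω hω => ?_
    apply Real.exp_le_exp.2
    have h1 : y ≤ c * X r ω := hω.1
    nlinarith [mul_le_mul_of_nonneg_right (hF r hr).2 (sq_nonneg c)]
  have hsum : Real.exp (y - c ^ 2 * u) * P.real {ω | ∃ r ∈ F, y ≤ c * X r ω} ≤ 1 := by
    rw [hU, measureReal_biUnion_finset hdisj hAm', Finset.mul_sum]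
    refine (Finset.sum_le_sum hle).trans ?_
    rw [← integral_biUnion_finset F hAm' hdisj fun r _ => (hint u hu).integrableOn, ← hone]
    exact setIntegral_le_integral (hint u hu) (Filter.Eventually.of_forall fun ω => by positivity)
  have : Real.exp (-y + c ^ 2 * u) = (Real.exp (y - c ^ 2 * u))⁻¹ := by
    rw [← Real.exp_neg]
    congr 1
    ring
  rw [this, ← one_div, le_div_iff₀' (Real.exp_pos _)]
  exact hsum

/-- All exponential moments of the running maximum of the absolute value are finite. -/
theorem exists_bound [IsProbabilityMeasure P] (hX : IsOneSidedBrownian X P) {u : ℝ}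
    (hu : 0 ≤ u) :
    ∃ S : Ω → ℝ, Measurable S ∧ (∀ ω, ∀ r ∈ Set.Icc 0 u, |X r ω| ≤ S ω) ∧
      ∀ κ : ℝ, 0 ≤ κ → Integrable (fun ω => Real.exp (κ * S ω)) P := by
  have : Nonempty (Set.Icc 0 u) := ⟨⟨0, le_refl 0, hu⟩⟩
  let q : ℕ → Set.Icc 0 u := TopologicalSpace.denseSeq (Set.Icc 0 u)
  have hq : DenseRange q := TopologicalSpace.denseRange_denseSeq _
  have hbdd : ∀ ω, BddAbove (Set.range fun n => |X (q n) ω|) := by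
    intro ω
    obtain ⟨M, hM⟩ := (isCompact_Icc (a := (0 : ℝ)) (b := u)).bddAbove_image
      (hX.cont ω).abs.continuousOn
    refine ⟨M, ?_⟩
    rintro _ ⟨n, rfl⟩
    exact hM ⟨_, (q n).2, rfl⟩
  have hSm : Measurable fun ω => ⨆ n, |X (q n) ω| :=
    Measurable.iSup fun n => by
      have := hX.meas (q n)
      fun_prop
  have hS0 : ∀ ω, 0 ≤ ⨆ n, |X (q n) ω| := fun ω => Real.iSup_nonneg fun n => abs_nonneg _
  refine ⟨fun ω => ⨆ n, |X (q n) ω|, hSm, ?_, ?_⟩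
  · intro ω r hr
    have hcl : IsClosed {p : Set.Icc 0 u | |X p ω| ≤ ⨆ n, |X (q n) ω|} :=
      isClosed_le ((hX.cont ω).comp continuous_subtype_val).abs continuous_const
    have : (⟨r, hr⟩ : Set.Icc 0 u) ∈ {p : Set.Icc 0 u | |X p ω| ≤ ⨆ n, |X (q n) ω|} := by
      refine hcl.closure_subset_iff.2 ?_ (hq ⟨r, hr⟩)
      rintro _ ⟨n, rfl⟩
      exact le_ciSup (hbdd ω) n
    exact this
  intro κ hκ
  have htail : ∀ c y : ℝ, 0 ≤ c → P {ω | ∃ n, y ≤ |X (q n) ω|} ≤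
      ENNReal.ofReal (2 * Real.exp (-(c * y) + c ^ 2 * u)) := by
    intro c y hc
    have hset : {ω | ∃ n, y ≤ |X (q n) ω|} = ⋃ N : ℕ, {ω | ∃ n ≤ N, y ≤ |X (q n) ω|} := by
      ext ω
      simp only [Set.mem_ofPred_eq, Set.mem_iUnion]
      exact ⟨fun ⟨n, hn⟩ => ⟨n, n, le_rfl, hn⟩, fun ⟨_, n, _, hn⟩ => ⟨n, hn⟩⟩
    rw [hset, Monotone.measure_iUnion]
    · refine iSup_le fun N => ?_
      classical
      let F : Finset ℝ := (Finset.range (N + 1)).image fun n => (q n : ℝ)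
      have hF : ∀ r ∈ F, 0 ≤ r ∧ r ≤ u := by
        intro r hr
        obtain ⟨n, -, rfl⟩ := Finset.mem_image.1 hr
        exact (q n).2
      have hsub : {ω | ∃ n ≤ N, y ≤ |X (q n) ω|} ⊆
          {ω | ∃ r ∈ F, c * y ≤ c * X r ω} ∪ {ω | ∃ r ∈ F, c * y ≤ -c * X r ω} := by
        rintro ω ⟨n, hn, hle⟩
        have hm : (q n : ℝ) ∈ F := Finset.mem_image.2 ⟨n, Finset.mem_range.2 (by omega), rfl⟩
        rcases le_abs.1 hle with h | h
        · exact Or.inl ⟨_, hm, mul_le_mul_of_nonneg_left h hc⟩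
        · refine Or.inr ⟨_, hm, ?_⟩
          have := mul_le_mul_of_nonneg_left h hc
          linarith
      rw [← ENNReal.ofReal_toReal (measure_ne_top P _)]
      apply ENNReal.ofReal_le_ofReal
      have h1 := hX.measureReal_exists_le c (c * y) F hF hu
      have h2 := hX.measureReal_exists_le (-c) (c * y) F hF hu
      rw [neg_sq] at h2
      calc P.real {ω | ∃ n ≤ N, y ≤ |X (q n) ω|} ≤ _ := measureReal_mono hsub
        _ ≤ _ := measureReal_union_le _ _
        _ ≤ _ := by linarith
    · intro N M hNM ω
      rintro ⟨n, hn, hle⟩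
      exact ⟨n, hn.trans hNM, hle⟩
  have hsm : Measurable fun ω => Real.exp (κ * ⨆ n, |X (q n) ω|) := by fun_prop
  refine ⟨hsm.aestronglyMeasurable, ?_⟩
  rw [hasFiniteIntegral_iff_norm]
  -- Split according to the integer part of the supremum.
  have hpt : ∀ ω, ENNReal.ofReal ‖Real.exp (κ * ⨆ n, |X (q n) ω|)‖ ≤
      ∑' m : ℕ, {ω | (m : ℝ) - 1 < ⨆ n, |X (q n) ω|}.indicator
        (fun _ => ENNReal.ofReal (Real.exp (κ * (m + 1)))) ω := by
    intro ω
    have hfl := Nat.floor_le (hS0 ω)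
    refine le_trans ?_ (ENNReal.le_tsum (⌊⨆ n, |X (q n) ω|⌋₊))
    rw [Set.indicator_of_mem (by simp only [Set.mem_ofPred_eq]; linarith), Real.norm_eq_abs,
      Real.abs_exp]
    apply ENNReal.ofReal_le_ofReal
    apply Real.exp_le_exp.2
    exact mul_le_mul_of_nonneg_left (Nat.lt_floor_add_one _).le hκ
  refine lt_of_le_of_lt (lintegral_mono hpt) ?_
  rw [lintegral_tsum fun m => (measurable_const.indicator
    (measurableSet_lt measurable_const hSm)).aemeasurable]
  -- The tail bound at rate `κ + 1` beats the factor `exp (κ (m + 1))` by `exp (-m)`.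
  let K : ℝ := 2 * Real.exp (κ + (κ + 1) + (κ + 1) ^ 2 * u)
  have hterm : ∀ m : ℕ, ∫⁻ ω, {ω | (m : ℝ) - 1 < ⨆ n, |X (q n) ω|}.indicator
      (fun _ => ENNReal.ofReal (Real.exp (κ * (m + 1)))) ω ∂P ≤
        ENNReal.ofReal (K * Real.exp (-1) ^ m) := by
    intro m
    rw [lintegral_indicator_const (measurableSet_lt measurable_const hSm)]
    have hsub : {ω | (m : ℝ) - 1 < ⨆ n, |X (q n) ω|} ⊆ {ω | ∃ n, (m : ℝ) - 1 ≤ |X (q n) ω|} := by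
      intro ω hω
      have hω' : (m : ℝ) - 1 < ⨆ n, |X (q n) ω| := hω
      obtain ⟨n, hn⟩ := exists_lt_of_lt_ciSup hω'
      exact ⟨n, hn.le⟩
    calc _ ≤ ENNReal.ofReal (Real.exp (κ * (m + 1))) * ENNReal.ofReal
          (2 * Real.exp (-((κ + 1) * ((m : ℝ) - 1)) + (κ + 1) ^ 2 * u)) := by
          gcongr
          exact (measure_mono hsub).trans (htail (κ + 1) _ (by linarith))
      _ = _ := by
          rw [← ENNReal.ofReal_mul (Real.exp_pos _).le, mul_left_comm, ← Real.exp_add,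
            ← Real.exp_nat_mul, mul_assoc, ← Real.exp_add]
          congr 3
          ring
  refine lt_of_le_of_lt (ENNReal.tsum_le_tsum hterm) ?_
  have hsum : Summable fun m : ℕ => K * Real.exp (-1) ^ m :=
    (summable_geometric_of_lt_one (Real.exp_pos _).le (by simp)).mul_left K
  rw [← ENNReal.ofReal_tsum_of_nonneg (fun m => by positivity) hsum]
  exact ENNReal.ofReal_lt_top

end IsOneSidedBrownian

end

/-! ### Optional stopping at the hitting time -/

section

variable {Ω : Type*}

theorem isLeast_sInf_hit {g : ℝ → EReal} (hg : UpperSemicontinuous g) {b : ℝ → ℝ}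
    (hb : Continuous b) {a : ℝ} (hne : ∃ t, a ≤ t ∧ (b t : EReal) ≤ g t) :
    IsLeast {t : ℝ | a ≤ t ∧ (b t : EReal) ≤ g t} (sInf {t : ℝ | a ≤ t ∧ (b t : EReal) ≤ g t}) := by
  have hcl : IsClosed {t : ℝ | a ≤ t ∧ (b t : EReal) ≤ g t} :=
    isClosed_Ici.inter (isClosed_setOf_coe_le hg hb)
  have hbd : BddBelow {t : ℝ | a ≤ t ∧ (b t : EReal) ≤ g t} := ⟨a, fun t ht => ht.1⟩
  exact ⟨hcl.csInf_mem hne hbd, fun t ht => csInf_le hbd ht⟩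

/-- The event that the path started at `s` meets the hypograph of `g` during `[0, t]`. -/
def hitBy (X : ℝ → Ω → ℝ) (g : ℝ → EReal) (s t : ℝ) : Set Ω :=
  {ω | ∃ r ∈ Set.Icc 0 t, ((s + X r ω : ℝ) : EReal) ≤ g r}

/-- The first time at which the path started at `s` meets the hypograph of `g`
(`0` if there is none, by the convention for the infimum of the empty set). -/
noncomputable def hitTime (X : ℝ → Ω → ℝ) (g : ℝ → EReal) (s : ℝ) (ω : Ω) : ℝ :=
  sInf {r : ℝ | 0 ≤ r ∧ ((s + X r ω : ℝ) : EReal) ≤ g r}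

open Classical in
/-- The exponential martingale evaluated at the first hitting time, and `0` if there is none. -/
noncomputable def stopWeight (X : ℝ → Ω → ℝ) (g : ℝ → EReal) (ξ : ℂ) (s : ℝ) (ω : Ω) : ℂ :=
  if ∃ r, 0 ≤ r ∧ ((s + X r ω : ℝ) : EReal) ≤ g r then expMart X ξ s (hitTime X g s ω) ω else 0

/-- The discretization of `stopWeight` that evaluates the exponential martingale at the first
point of the grid `0, δ, …, n δ` not before the hitting time: the `k`-th summand lives on the event that
the first hit occurs after `(k - 1) δ` and not after `k δ`. -/
noncomputable def gridWeight (X : ℝ → Ω → ℝ) (g : ℝ → EReal) (ξ : ℂ) (s δ : ℝ) (n : ℕ) (ω : Ω) :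
    ℂ :=
  ∑ k ∈ Finset.range (n + 1),
    (disjointed (fun k : ℕ => hitBy X g s (k * δ)) k).indicator (expMart X ξ s (k * δ)) ω

theorem hitBy_mono (X : ℝ → Ω → ℝ) (g : ℝ → EReal) (s : ℝ) : Monotone (hitBy X g s) := by
  rintro t t' h ω ⟨r, hr, hle⟩
  exact ⟨r, ⟨hr.1, hr.2.trans h⟩, hle⟩

theorem norm_expMart_le {X : ℝ → Ω → ℝ} (ξ : ℂ) (s : ℝ) {t u b : ℝ} {ω : Ω} (ht : 0 ≤ t)
    (htu : t ≤ u) (hb : |X t ω| ≤ b) :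
    ‖expMart X ξ s t ω‖ ≤ Real.exp (u * ‖ξ‖ ^ 2 + ‖ξ‖ * |s|) * Real.exp (‖ξ‖ * b) := by
  rw [expMart, Complex.norm_exp, ← Real.exp_add]
  apply Real.exp_le_exp.2
  refine (Complex.re_le_norm _).trans ((norm_sub_le _ _).trans ?_)
  rw [norm_mul, norm_mul, norm_neg, norm_pow, Complex.norm_real, Complex.norm_real,
    Real.norm_eq_abs, Real.norm_eq_abs, abs_of_nonneg ht]
  have h1 : t * ‖ξ‖ ^ 2 ≤ u * ‖ξ‖ ^ 2 := by gcongr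
  have h2 : |s + X t ω| * ‖ξ‖ ≤ (|s| + b) * ‖ξ‖ := by
    gcongr
    exact (abs_add_le _ _).trans (by linarith)
  linarith

variable {X : ℝ → Ω → ℝ} {g : ℝ → EReal}

theorem measurableSet_hitBy (hX : ∀ ω, Continuous fun t => X t ω) (hg : UpperSemicontinuous g) (s : ℝ)
    {t : ℝ} {m : MeasurableSpace Ω} (hm : ∀ r ∈ Set.Icc 0 t, Measurable[m] (X r)) :
    MeasurableSet[m] (hitBy X g s t) :=
  measurableSet_hit (m := m) hg (Y := fun r ω => s + X r ω) (fun r hr => (hm r hr).const_add s)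
    fun ω => continuous_const.add (hX ω)

theorem continuous_expMart (hX : ∀ ω, Continuous fun t => X t ω) (ξ : ℂ) (s : ℝ) (ω : Ω) :
    Continuous fun t => expMart X ξ s t ω := by
  have := hX ω
  unfold expMart
  fun_prop

/-- On the event of a hit, the discretization is the exponential martingale at a time that exceeds
the hitting time by at most the mesh. -/
theorem exists_gridWeight_eq (hX : ∀ ω, Continuous fun t => X t ω) (hg : UpperSemicontinuous g) (ξ : ℂ)
    (s : ℝ) {δ : ℝ} (hδ : 0 < δ) {n : ℕ} {ω : Ω} (hω : ω ∈ hitBy X g s (n * δ)) :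
    ∃ t, 0 ≤ t ∧ t ≤ n * δ ∧ hitTime X g s ω ≤ t ∧ t ≤ hitTime X g s ω + δ ∧
      gridWeight X g ξ s δ n ω = expMart X ξ s t ω := by
  obtain ⟨r, hr, hle⟩ := hω
  have hleast : IsLeast {r : ℝ | 0 ≤ r ∧ ((s + X r ω : ℝ) : EReal) ≤ g r} (hitTime X g s ω) :=
    isLeast_sInf_hit hg (continuous_const.add (hX ω)) ⟨r, hr.1, hle⟩
  set σ := hitTime X g s ω
  have hσ0 : 0 ≤ σ := hleast.1.1
  have hσ1 : ((s + X σ ω : ℝ) : EReal) ≤ g σ := hleast.1.2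
  have hσr : σ ≤ n * δ := (hleast.2 ⟨hr.1, hle⟩).trans hr.2
  let k := ⌈σ / δ⌉₊
  have hk1 : σ ≤ k * δ := (div_le_iff₀ hδ).1 (Nat.le_ceil _)
  have hk2 : k * δ ≤ σ + δ := by
    have := (Nat.ceil_lt_add_one (div_nonneg hσ0 hδ.le)).le
    calc (k : ℝ) * δ ≤ (σ / δ + 1) * δ := by gcongr
      _ = σ + δ := by field_simp
  have hkn : k ≤ n := Nat.ceil_le.2 ((div_le_iff₀ hδ).2 hσr)
  have hmem : ω ∈ disjointed (fun k : ℕ => hitBy X g s (k * δ)) k := by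
    rw [disjointed_eq_inter_compl]
    refine ⟨⟨σ, ⟨hσ0, hk1⟩, hσ1⟩, ?_⟩
    simp only [Set.mem_iInter, Set.mem_compl_iff]
    rintro j hj ⟨r', hr', hle'⟩
    have h1 : σ ≤ j * δ := (hleast.2 ⟨hr'.1, hle'⟩).trans hr'.2
    have h2 : k ≤ j := Nat.ceil_le.2 ((div_le_iff₀ hδ).2 h1)
    omega
  refine ⟨k * δ, by positivity, by gcongr, hk1, hk2, ?_⟩
  rw [gridWeight, Finset.sum_eq_single k]
  · rw [Set.indicator_of_mem hmem]
  · intro j _ hj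
    refine Set.indicator_of_notMem (fun h => ?_) _
    exact Set.disjoint_left.1 (disjoint_disjointed (fun k : ℕ => hitBy X g s (k * δ)) hj) h hmem
  · intro h
    exact absurd (Finset.mem_range.2 (by omega)) h

theorem gridWeight_eq_zero (ξ : ℂ) (s : ℝ) {δ : ℝ} (hδ : 0 < δ) {n : ℕ} {ω : Ω}
    (hω : ω ∉ hitBy X g s (n * δ)) : gridWeight X g ξ s δ n ω = 0 := by
  refine Finset.sum_eq_zero fun k hk => Set.indicator_of_notMem (fun h => hω ?_) _
  have hk' : k ≤ n := by simpa [Nat.lt_succ_iff] using hk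
  exact hitBy_mono X g s (by gcongr)
    (disjointed_subset (fun k : ℕ => hitBy X g s (k * δ)) k h)

theorem measurable_gridWeight (hX : ∀ ω, Continuous fun t => X t ω) (hg : UpperSemicontinuous g) (ξ : ℂ)
    (s : ℝ) {δ : ℝ} (hδ : 0 < δ) {n : ℕ} {m : MeasurableSpace Ω}
    (hm : ∀ r ∈ Set.Icc 0 (n * δ), Measurable[m] (X r)) :
    Measurable[m] (gridWeight X g ξ s δ n) := by
  refine Finset.measurable_fun_sum _ fun k hk => ?_
  have hk' : (k : ℝ) * δ ≤ n * δ := by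
    have : k ≤ n := by simpa [Nat.lt_succ_iff] using hk
    gcongr
  have hXk : Measurable[m] (X (k * δ)) := hm _ ⟨by positivity, hk'⟩
  refine Measurable.indicator ?_ ?_
  · unfold expMart
    fun_prop
  · rw [disjointed_eq_inter_compl]
    refine (measurableSet_hitBy hX hg s fun r hr => hm r ⟨hr.1, hr.2.trans hk'⟩).inter ?_
    refine MeasurableSet.iInter fun j => MeasurableSet.iInter fun hj => ?_
    refine (measurableSet_hitBy hX hg s fun r hr => hm r ⟨hr.1, hr.2.trans (le_trans ?_ hk')⟩).compl
    have : j ≤ k := hj.le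
    gcongr

theorem tendsto_gridWeight {u : ℝ} (hX : ∀ ω, Continuous fun t => X t ω) (hg : UpperSemicontinuous g) (hu : 0 < u)
    (hgu : ∀ t, u < t → g t = ⊥) (ξ : ℂ) (s : ℝ) (ω : Ω) :
    Filter.Tendsto (fun n : ℕ => gridWeight X g ξ s (u / ((n + 1 : ℕ) : ℝ)) (n + 1) ω)
      Filter.atTop (nhds (stopWeight X g ξ s ω)) := by
  have hn : ∀ n : ℕ, ((n + 1 : ℕ) : ℝ) * (u / ((n + 1 : ℕ) : ℝ)) = u := fun n =>
    mul_div_cancel₀ _ (by positivity)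
  have hδ : ∀ n : ℕ, 0 < u / ((n + 1 : ℕ) : ℝ) := fun n => by positivity
  by_cases hω : ω ∈ hitBy X g s u
  · have hex : ∃ r, 0 ≤ r ∧ ((s + X r ω : ℝ) : EReal) ≤ g r := by
      obtain ⟨r, hr, hle⟩ := hω
      exact ⟨r, hr.1, hle⟩
    have hval : stopWeight X g ξ s ω = expMart X ξ s (hitTime X g s ω) ω := if_pos hex
    have h := fun n => exists_gridWeight_eq hX hg ξ s (hδ n) (n := n + 1)
      (by rw [hn]; exact hω)
    choose t ht0 htu ht1 ht2 heq using h
    simp_rw [heq, hval]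
    refine ((continuous_expMart hX ξ s ω).tendsto _).comp ?_
    have hlim : Filter.Tendsto (fun n : ℕ => hitTime X g s ω + u / ((n + 1 : ℕ) : ℝ))
        Filter.atTop (nhds (hitTime X g s ω)) := by
      have := (tendsto_const_div_atTop_nhds_zero_nat u).comp (Filter.tendsto_add_atTop_nat 1)
      simpa using this.const_add (hitTime X g s ω)
    exact tendsto_of_tendsto_of_tendsto_of_le_of_le tendsto_const_nhds hlim ht1 ht2
  · have hex : ¬ ∃ r, 0 ≤ r ∧ ((s + X r ω : ℝ) : EReal) ≤ g r := by
      rintro ⟨r, hr, hle⟩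
      refine hω ⟨r, ⟨hr, ?_⟩, hle⟩
      by_contra hcon
      rw [hgu r (not_le.1 hcon), le_bot_iff] at hle
      exact EReal.coe_ne_bot _ hle
    have hval : stopWeight X g ξ s ω = 0 := if_neg hex
    rw [hval]
    refine tendsto_const_nhds.congr fun n => (gridWeight_eq_zero ξ s (hδ n) ?_).symm
    rw [hn]
    exact hω

theorem measurable_stopWeight {u : ℝ} (hX : ∀ ω, Continuous fun t => X t ω) (hg : UpperSemicontinuous g) (hu : 0 < u)
    (hgu : ∀ t, u < t → g t = ⊥) (ξ : ℂ) (s : ℝ) {m : MeasurableSpace Ω}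
    (hm : ∀ r ∈ Set.Icc 0 u, Measurable[m] (X r)) : Measurable[m] (stopWeight X g ξ s) := by
  refine @measurable_of_tendsto_metrizable Ω ℂ m _ _ _ _ _ _
    (fun n => ?_) (tendsto_pi_nhds.2 fun ω => tendsto_gridWeight hX hg hu hgu ξ s ω)
  refine measurable_gridWeight hX hg ξ s (by positivity) fun r hr => hm r ?_
  rwa [mul_div_cancel₀ _ (by positivity)] at hr

variable [MeasurableSpace Ω] {P : Measure Ω}

namespace IsOneSidedBrownian

theorem integrable_expMart [IsProbabilityMeasure P] (hX : IsOneSidedBrownian X P) (ξ : ℂ) (s : ℝ)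
    {t : ℝ} (ht : 0 ≤ t) : Integrable (expMart X ξ s t) P := by
  obtain ⟨S, -, hS, hexp⟩ := hX.exists_bound ht
  refine Integrable.mono' ((hexp ‖ξ‖ (norm_nonneg _)).const_mul _)
    (hX.measurable_expMart ξ s t).aestronglyMeasurable
    (Filter.Eventually.of_forall fun ω => norm_expMart_le ξ s ht le_rfl (hS ω t ⟨ht, le_rfl⟩))

/-- Optional stopping for the discretized hitting time. -/
theorem integral_gridWeight [IsProbabilityMeasure P] (hX : IsOneSidedBrownian X P)
    (hg : UpperSemicontinuous g) (ξ : ℂ) (s : ℝ) {δ : ℝ} (hδ : 0 < δ) (n : ℕ) :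
    ∫ ω, gridWeight X g ξ s δ n ω ∂P =
      ∫ ω, (hitBy X g s (n * δ)).indicator (expMart X ξ s (n * δ)) ω ∂P := by
  have hmeas : ∀ k : ℕ, MeasurableSet[pathSigma X (k * δ)]
      (disjointed (fun k : ℕ => hitBy X g s (k * δ)) k) := by
    intro k
    rw [disjointed_eq_inter_compl]
    refine (measurableSet_hitBy hX.cont hg s fun r hr => measurable_pathSigma X hr.1 hr.2).inter ?_
    refine MeasurableSet.iInter fun j => MeasurableSet.iInter fun hj => ?_
    refine (measurableSet_hitBy hX.cont hg s fun r hr =>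
      measurable_pathSigma X hr.1 (hr.2.trans ?_)).compl
    have : j ≤ k := hj.le
    gcongr
  have hmeas' : ∀ k : ℕ, MeasurableSet (disjointed (fun k : ℕ => hitBy X g s (k * δ)) k) :=
    fun k => hX.pathSigma_le _ _ (hmeas k)
  have hU : hitBy X g s (n * δ) =
      ⋃ k ∈ Finset.range (n + 1), disjointed (fun k : ℕ => hitBy X g s (k * δ)) k := by
    have h := biUnion_range_succ_disjointed (fun k : ℕ => hitBy X g s (k * δ)) n
    have hmono : Monotone fun k : ℕ => hitBy X g s (k * δ) := fun j k hjk =>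
      hitBy_mono X g s (by gcongr)
    rw [Monotone.partialSups_eq hmono] at h
    exact h.symm
  have hsum : (hitBy X g s (n * δ)).indicator (expMart X ξ s (n * δ)) = fun ω =>
      ∑ k ∈ Finset.range (n + 1), (disjointed (fun k : ℕ => hitBy X g s (k * δ)) k).indicator
        (expMart X ξ s (n * δ)) ω := by
    rw [hU]
    exact Finset.indicator_biUnion _ _ fun i _ j _ hij =>
      disjoint_disjointed (fun k : ℕ => hitBy X g s (k * δ)) hij
  rw [hsum]
  unfold gridWeight
  rw [integral_finsetSum _ fun k _ =>
      (hX.integrable_expMart ξ s (by positivity)).indicator (hmeas' k),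
    integral_finsetSum _ fun k _ =>
      (hX.integrable_expMart ξ s (by positivity)).indicator (hmeas' k)]
  refine Finset.sum_congr rfl fun k hk => ?_
  have : k ≤ n := by simpa [Nat.lt_succ_iff] using hk
  exact (hX.integral_indicator_expMart ξ s (by positivity) (by gcongr) (hmeas k)).symm

/-- Optional stopping at the hitting time: the weight of the first hit has the same expectation
as the exponential martingale at the final time `u`, restricted to the event of a hit. -/
theorem integrable_stopWeight_and_integral_eq [IsProbabilityMeasure P] {u : ℝ}
    (hX : IsOneSidedBrownian X P) (hg : UpperSemicontinuous g) (hu : 0 < u)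
    (hgu : ∀ t, u < t → g t = ⊥) (ξ : ℂ) (s : ℝ) :
    Integrable (stopWeight X g ξ s) P ∧
      ∫ ω, stopWeight X g ξ s ω ∂P = ∫ ω, (hitBy X g s u).indicator (expMart X ξ s u) ω ∂P := by
  obtain ⟨S, -, hS, hexp⟩ := hX.exists_bound hu.le
  have hn : ∀ n : ℕ, ((n + 1 : ℕ) : ℝ) * (u / ((n + 1 : ℕ) : ℝ)) = u := fun n =>
    mul_div_cancel₀ _ (by positivity)
  have hδ : ∀ n : ℕ, 0 < u / ((n + 1 : ℕ) : ℝ) := fun n => by positivity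
  have hbound : Integrable (fun ω => Real.exp (u * ‖ξ‖ ^ 2 + ‖ξ‖ * |s|) * Real.exp (‖ξ‖ * S ω)) P :=
    (hexp ‖ξ‖ (norm_nonneg _)).const_mul _
  have hle : ∀ (n : ℕ) (ω : Ω), ‖gridWeight X g ξ s (u / ((n + 1 : ℕ) : ℝ)) (n + 1) ω‖ ≤
      Real.exp (u * ‖ξ‖ ^ 2 + ‖ξ‖ * |s|) * Real.exp (‖ξ‖ * S ω) := by
    intro n ω
    by_cases hω : ω ∈ hitBy X g s (((n + 1 : ℕ) : ℝ) * (u / ((n + 1 : ℕ) : ℝ)))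
    · obtain ⟨t, ht0, htu, -, -, heq⟩ := exists_gridWeight_eq hX.cont hg ξ s (hδ n) hω
      rw [hn] at htu
      rw [heq]
      exact norm_expMart_le ξ s ht0 htu (hS ω t ⟨ht0, htu⟩)
    · rw [gridWeight_eq_zero ξ s (hδ n) hω, norm_zero]
      positivity
  have hlim := tendsto_gridWeight hX.cont hg hu hgu ξ s
  refine ⟨Integrable.mono' hbound
    (measurable_stopWeight hX.cont hg hu hgu ξ s fun r _ => hX.meas r).aestronglyMeasurable
    (Filter.Eventually.of_forall fun ω => le_of_tendsto (hlim ω).norm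
      (Filter.Eventually.of_forall fun n => hle n ω)), ?_⟩
  have h := tendsto_integral_of_dominated_convergence _
    (fun n => (measurable_gridWeight hX.cont hg ξ s (hδ n) (n := n + 1)
      fun r _ => hX.meas r).aestronglyMeasurable) hbound
    (fun n => Filter.Eventually.of_forall (hle n)) (Filter.Eventually.of_forall hlim)
  refine tendsto_nhds_unique h (tendsto_const_nhds.congr fun n => ?_)
  rw [hX.integral_gridWeight hg ξ s (hδ n), hn]

end IsOneSidedBrownian

end

/-! ### Two-sided Brownian motion -/

section

variable {Ω : Type*}

/-- The forward increments `W (a + t) - W a` of a two-sided process. -/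
def fwd (W : ℝ → Ω → ℝ) (a t : ℝ) (ω : Ω) : ℝ := W (a + t) ω - W a ω

/-- The backward increments `W (a - t) - W a` of a two-sided process. -/
def bwd (W : ℝ → Ω → ℝ) (a t : ℝ) (ω : Ω) : ℝ := W (a - t) ω - W a ω

/-- The σ-algebra generated by the increments of `W` before time `a`. -/
abbrev pastSigma (W : ℝ → Ω → ℝ) (a : ℝ) : MeasurableSpace Ω :=
  MeasurableSpace.comap (fun ω (r : Set.Iic a) => W r ω - W a ω) MeasurableSpace.pi

/-- The σ-algebra generated by the increments of `W` after time `a`. -/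
abbrev futureSigma (W : ℝ → Ω → ℝ) (a : ℝ) : MeasurableSpace Ω :=
  MeasurableSpace.comap (fun ω (r : Set.Ici a) => W r ω - W a ω) MeasurableSpace.pi

theorem measurable_pastSigma (W : ℝ → Ω → ℝ) {r a : ℝ} (hr : r ≤ a) :
    Measurable[pastSigma W a] (fun ω => W r ω - W a ω) :=
  (measurable_pi_apply (⟨r, hr⟩ : Set.Iic a)).comp
    (comap_measurable (fun ω (r : Set.Iic a) => W r ω - W a ω))

theorem measurable_futureSigma (W : ℝ → Ω → ℝ) {r a : ℝ} (hr : a ≤ r) :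
    Measurable[futureSigma W a] (fun ω => W r ω - W a ω) :=
  (measurable_pi_apply (⟨r, hr⟩ : Set.Ici a)).comp
    (comap_measurable (fun ω (r : Set.Ici a) => W r ω - W a ω))

theorem measurable_sub_pastSigma (W : ℝ → Ω → ℝ) {r r' a : ℝ} (hr : r ≤ a) (hr' : r' ≤ a) :
    Measurable[pastSigma W a] (fun ω => W r ω - W r' ω) := by
  have := (measurable_pastSigma W hr).sub (measurable_pastSigma W hr')
  convert this using 2
  simp

theorem measurable_sub_futureSigma (W : ℝ → Ω → ℝ) {r r' a : ℝ} (hr : a ≤ r) (hr' : a ≤ r') :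
    Measurable[futureSigma W a] (fun ω => W r ω - W r' ω) := by
  have := (measurable_futureSigma W hr).sub (measurable_futureSigma W hr')
  convert this using 2
  simp

theorem measurable_bwd_pastSigma (W : ℝ → Ω → ℝ) (a : ℝ) {t : ℝ} (ht : 0 ≤ t) :
    Measurable[pastSigma W a] (bwd W a t) :=
  measurable_pastSigma W (by linarith)

theorem measurable_fwd_futureSigma (W : ℝ → Ω → ℝ) (a : ℝ) {t : ℝ} (ht : 0 ≤ t) :
    Measurable[futureSigma W a] (fwd W a t) :=
  measurable_futureSigma W (by linarith)

theorem measurable_expMart_fwd (W : ℝ → Ω → ℝ) {a u : ℝ} (hu : 0 ≤ u) (ξ : ℂ) (s : ℝ) :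
    Measurable[futureSigma W a] (expMart (fwd W a) ξ s u) := by
  have := measurable_fwd_futureSigma W a hu
  unfold expMart
  fun_prop

theorem measurable_expMart_bwd (W : ℝ → Ω → ℝ) {a u : ℝ} (hu : 0 ≤ u) (ξ : ℂ) (s : ℝ) :
    Measurable[pastSigma W a] (expMart (bwd W a) ξ s u) := by
  have := measurable_bwd_pastSigma W a hu
  unfold expMart
  fun_prop

/-- A nonempty finite set of reals is contained in the range of a monotone sequence. -/
theorem exists_monotone_seq (T : Finset ℝ) (hT : T.Nonempty) :
    ∃ t : ℕ → ℝ, Monotone t ∧ ∀ x ∈ T, ∃ n, t n = x := by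
  have hpos : 0 < T.card := hT.card_pos
  refine ⟨fun k => T.orderEmbOfFin rfl ⟨min k (T.card - 1), by omega⟩, ?_, ?_⟩
  · intro i j hij
    apply (T.orderEmbOfFin rfl).monotone
    simp only [Fin.mk_le_mk]
    omega
  · intro x hx
    have : x ∈ Set.range (T.orderEmbOfFin rfl) := by
      rw [Finset.range_orderEmbOfFin]
      exact hx
    obtain ⟨⟨n, hn⟩, rfl⟩ := this
    refine ⟨n, ?_⟩
    refine congrArg (T.orderEmbOfFin rfl) ?_
    exact Fin.ext (min_eq_left (Nat.le_sub_one_of_lt hn))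

variable [MeasurableSpace Ω] {P : Measure Ω}

/-- A two-sided Brownian motion all of whose paths are continuous and vanish at `0`, and all of
whose coordinates are measurable. -/
structure IsRegularTwoSidedBrownian (W : ℝ → Ω → ℝ) (P : Measure Ω) : Prop where
  zero : ∀ ω, W 0 ω = 0
  cont : ∀ ω, Continuous fun t => W t ω
  meas : ∀ t, Measurable (W t)
  indep : HasIndepIncrements W P
  law : ∀ s t : ℝ, s ≤ t → HasLaw (W t - W s) (gaussianReal 0 (Real.toNNReal (2 * (t - s)))) P

/-- A two-sided Brownian motion is indistinguishable from a regular one. -/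
theorem IsTwoSidedBrownian.exists_regular {W : ℝ → Ω → ℝ} (hW : IsTwoSidedBrownian W P) :
    ∃ V : ℝ → Ω → ℝ, IsRegularTwoSidedBrownian V P ∧ ∀ᵐ ω ∂P, ∀ t, V t ω = W t ω := by
  have hm0 : AEMeasurable (W 0) P :=
    (aemeasurable_const (b := (0 : ℝ))).congr (hW.zero.mono fun ω h => h.symm)
  have hm : ∀ t, AEMeasurable (W t) P := by
    intro t
    rcases le_total 0 t with ht | ht
    · have := (hW.law 0 t ht).aemeasurable.add hm0
      simpa using this
    · have := hm0.sub (hW.law t 0 ht).aemeasurable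
      simpa using this
  have hgood : ∀ᵐ ω ∂P, W 0 ω = 0 ∧ (Continuous fun t => W t ω) ∧
      ∀ q : ℚ, W q ω = (hm q).mk (W q) ω :=
    hW.zero.and (hW.cont.and (ae_all_iff.2 fun q => (hm q).ae_eq_mk))
  obtain ⟨G, hG, hGm, hGsub⟩ := hgood.exists_measurable_mem
  -- On `G` the path is continuous and measurable at rational times, hence measurable at all times;
  -- on the null set `Gᶜ` it is replaced by `0`.
  classical
  let V : ℝ → Ω → ℝ := fun t => G.indicator (W t)
  have hVW : ∀ᵐ ω ∂P, ∀ t, V t ω = W t ω := by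
    filter_upwards [hG] with ω hω t
    exact Set.indicator_of_mem hω _
  have hcont : ∀ ω, Continuous fun t => V t ω := by
    intro ω
    by_cases hω : ω ∈ G
    · simpa only [V, Set.indicator_of_mem hω] using (hGsub ω hω).2.1
    · simpa only [V, Set.indicator_of_notMem hω] using continuous_const
  have hq : ∀ q : ℚ, Measurable (V q) := by
    intro q
    have : V q = G.indicator ((hm q).mk (W q)) := by
      ext ω
      by_cases hω : ω ∈ G
      · simp only [V, Set.indicator_of_mem hω, (hGsub ω hω).2.2 q]
      · simp only [V, Set.indicator_of_notMem hω]
    rw [this]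
    exact (hm q).measurable_mk.indicator hGm
  have hmeas : ∀ t, Measurable (V t) := by
    intro t
    obtain ⟨q, hqt⟩ : ∃ q : ℕ → ℚ, Filter.Tendsto (fun n => (q n : ℝ)) Filter.atTop (nhds t) := by
      obtain ⟨x, hx, hlim⟩ := mem_closure_iff_seq_limit.1 (Rat.denseRange_cast (𝕜 := ℝ) t)
      choose q hq using hx
      exact ⟨q, by simpa only [hq] using hlim⟩
    exact measurable_of_tendsto_metrizable (fun n => hq (q n))
      (tendsto_pi_nhds.2 fun ω => ((hcont ω).tendsto t).comp hqt)
  refine ⟨V, ⟨?_, hcont, hmeas, ?_, ?_⟩, hVW⟩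
  · intro ω
    by_cases hω : ω ∈ G
    · simp only [V, Set.indicator_of_mem hω, (hGsub ω hω).1]
    · simp only [V, Set.indicator_of_notMem hω]
  · intro n t ht
    refine (hW.indep n t ht).congr fun i => ?_
    filter_upwards [hVW] with ω hω
    rw [hω, hω]
  · intro s t hst
    refine (hW.law s t hst).congr ?_
    filter_upwards [hVW] with ω hω
    simp [hω]

namespace IsRegularTwoSidedBrownian

variable {W : ℝ → Ω → ℝ}

theorem pastSigma_le (hW : IsRegularTwoSidedBrownian W P) (a : ℝ) :
    pastSigma W a ≤ ‹MeasurableSpace Ω› :=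
  (measurable_pi_lambda (fun ω (r : Set.Iic a) => W r ω - W a ω)
    fun r => (hW.meas r).sub (hW.meas a)).comap_le

theorem futureSigma_le (hW : IsRegularTwoSidedBrownian W P) (a : ℝ) :
    futureSigma W a ≤ ‹MeasurableSpace Ω› :=
  (measurable_pi_lambda (fun ω (r : Set.Ici a) => W r ω - W a ω)
    fun r => (hW.meas r).sub (hW.meas a)).comap_le

/-- The increments before time `a` are independent of the increments after time `a`. -/
theorem indep_past_future [IsProbabilityMeasure P] (hW : IsRegularTwoSidedBrownian W P) (a : ℝ) :
    Indep (pastSigma W a) (futureSigma W a) P := by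
  refine (IndepFun_iff_Indep _ _ _).1 ?_
  refine IndepFun.process_indepFun_process (fun r => (hW.meas r).sub (hW.meas a))
    (fun r => (hW.meas r).sub (hW.meas a)) fun I J => ?_
  classical
  obtain ⟨t, ht, hrange⟩ := exists_monotone_seq
    (insert a (I.image Subtype.val ∪ J.image Subtype.val)) (Finset.insert_nonempty _ _)
  obtain ⟨m, hm⟩ := hrange a (Finset.mem_insert_self _ _)
  -- Increments of `W` before (after) `a = t m` are sums of the elementary increments with index
  -- `k < m` (`m ≤ k`), and these two blocks are independent.
  let inc : ℕ → Ω → ℝ := fun k ω => W (t (k + 1)) ω - W (t k) ω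
  have hinc : iIndepFun inc P := hW.indep.nat ht
  have hincm : ∀ k, Measurable (inc k) := fun k => (hW.meas _).sub (hW.meas _)
  let M : ℕ → MeasurableSpace Ω := fun k => MeasurableSpace.comap (inc k) inferInstance
  have hind : Indep (⨆ k ∈ {k | k < m}, M k) (⨆ k ∈ {k | m ≤ k}, M k) P := by
    refine indep_iSup_of_disjoint (fun k => (hincm k).comap_le) hinc ?_
    rw [Set.disjoint_left]
    intro k h1 h2
    exact absurd (show k < m from h1) (not_lt.2 h2)
  have hmk : ∀ (S : Set ℕ), ∀ k ∈ S, Measurable[⨆ k ∈ S, M k] (inc k) := fun S k hk =>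
    (comap_measurable (inc k)).mono (le_biSup M hk) le_rfl
  rw [IndepFun_iff_Indep]
  refine indep_of_indep_of_le_left (indep_of_indep_of_le_right hind ?_) ?_
  · refine Measurable.comap_le ((@measurable_pi_iff _ _ _ (_) _ _).2 fun r => ?_)
    obtain ⟨n, hn⟩ := hrange (r : Set.Ici a) (Finset.mem_insert_of_mem
      (Finset.mem_union_right _ (Finset.mem_image_of_mem _ r.2)))
    obtain ⟨n, hmn, hn⟩ : ∃ n, m ≤ n ∧ t n = (r : Set.Ici a) := by
      rcases le_total m n with h | h
      · exact ⟨n, h, hn⟩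
      · refine ⟨m, le_rfl, le_antisymm (hm.le.trans (r : Set.Ici a).2) ?_⟩
        rw [← hn]
        exact ht h
    have heq : (fun ω => W (r : Set.Ici a) ω - W a ω) = fun ω => ∑ k ∈ Finset.Ico m n, inc k ω := by
      ext ω
      rw [Finset.sum_Ico_sub (fun k => W (t k) ω) hmn, hn, hm]
    rw [heq]
    exact Finset.measurable_fun_sum _ fun k hk => hmk {k | m ≤ k} k (Finset.mem_Ico.1 hk).1
  · refine Measurable.comap_le ((@measurable_pi_iff _ _ _ (_) _ _).2 fun r => ?_)
    obtain ⟨n, hn⟩ := hrange (r : Set.Iic a) (Finset.mem_insert_of_mem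
      (Finset.mem_union_left _ (Finset.mem_image_of_mem _ r.2)))
    obtain ⟨n, hmn, hn⟩ : ∃ n, n ≤ m ∧ t n = (r : Set.Iic a) := by
      rcases le_total n m with h | h
      · exact ⟨n, h, hn⟩
      · refine ⟨m, le_rfl, le_antisymm ?_ ((r : Set.Iic a).2.trans hm.ge)⟩
        rw [← hn]
        exact ht h
    have heq : (fun ω => W (r : Set.Iic a) ω - W a ω) =
        fun ω => -∑ k ∈ Finset.Ico n m, inc k ω := by
      ext ω
      rw [Finset.sum_Ico_sub (fun k => W (t k) ω) hmn, hn, hm, neg_sub]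
    rw [heq]
    exact (Finset.measurable_fun_sum _ fun k hk => hmk {k | k < m} k (Finset.mem_Ico.1 hk).2).neg

theorem isOneSidedBrownian_fwd [IsProbabilityMeasure P] (hW : IsRegularTwoSidedBrownian W P)
    (a : ℝ) : IsOneSidedBrownian (fwd W a) P where
  zero ω := by simp [fwd]
  cont ω := by
    have := hW.cont ω
    unfold fwd
    fun_prop
  meas t := (hW.meas _).sub (hW.meas _)
  law s t hs hst := by
    have h := hW.law (a + s) (a + t) (by linarith)
    rw [add_sub_add_left_eq_sub] at h
    refine h.congr (Filter.Eventually.of_forall fun ω => ?_)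
    simp [fwd]
  indep s t hs hst := by
    rw [IndepFun_iff_Indep]
    refine indep_of_indep_of_le_left
      (indep_of_indep_of_le_right (hW.indep_past_future (a + s)) ?_) ?_
    · apply Measurable.comap_le
      have := measurable_futureSigma W (show a + s ≤ a + t by linarith)
      convert this using 2
      simp [fwd]
    · refine Measurable.comap_le ((@measurable_pi_iff _ _ _ (_) _ _).2 fun r => ?_)
      exact measurable_sub_pastSigma W (by linarith [r.2.2]) (by linarith)

theorem isOneSidedBrownian_bwd [IsProbabilityMeasure P] (hW : IsRegularTwoSidedBrownian W P)
    (a : ℝ) : IsOneSidedBrownian (bwd W a) P where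
  zero ω := by simp [bwd]
  cont ω := by
    have := hW.cont ω
    unfold bwd
    fun_prop
  meas t := (hW.meas _).sub (hW.meas _)
  law s t hs hst := by
    have h := hW.law (a - t) (a - s) (by linarith)
    rw [sub_sub_sub_cancel_left] at h
    have h2 : HasLaw (fun x : ℝ => -x) (gaussianReal 0 (Real.toNNReal (2 * (t - s))))
        (gaussianReal 0 (Real.toNNReal (2 * (t - s)))) :=
      ⟨by fun_prop, by rw [gaussianReal_map_neg, neg_zero]⟩
    refine (h2.comp h).congr (Filter.Eventually.of_forall fun ω => ?_)
    simp [bwd]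
  indep s t hs hst := by
    rw [IndepFun_iff_Indep]
    refine indep_of_indep_of_le_left
      (indep_of_indep_of_le_right (hW.indep_past_future (a - s)).symm ?_) ?_
    · apply Measurable.comap_le
      have := measurable_pastSigma W (show a - t ≤ a - s by linarith)
      convert this using 2
      simp [bwd]
    · refine Measurable.comap_le ((@measurable_pi_iff _ _ _ (_) _ _).2 fun r => ?_)
      exact measurable_sub_futureSigma W (by linarith [r.2.2]) (by linarith)

end IsRegularTwoSidedBrownian

end

/-! ### Hitting times and weights -/

theorem tauPlus_eq_coe {h : ℝ → EReal} {a x : ℝ} {b : ℝ → ℝ}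
    (hx : IsLeast {t : ℝ | a ≤ t ∧ (b t : EReal) ≤ h t} x) : tauPlus h a b = x :=
  (EReal.coe_strictMono.monotone.map_isLeast hx).isGLB.sInf_eq

theorem tauMinus_eq_coe {h : ℝ → EReal} {a x : ℝ} {b : ℝ → ℝ}
    (hx : IsGreatest {t : ℝ | t ≤ a ∧ (b t : EReal) ≤ h t} x) : tauMinus h a b = x :=
  (EReal.coe_strictMono.monotone.map_isGreatest hx).isLUB.sSup_eq

theorem tauPlus_eq_top {h : ℝ → EReal} {a : ℝ} {b : ℝ → ℝ}
    (hne : ¬ ∃ t, a ≤ t ∧ (b t : EReal) ≤ h t) : tauPlus h a b = ⊤ := by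
  have : {t : ℝ | a ≤ t ∧ (b t : EReal) ≤ h t} = ∅ :=
    Set.eq_empty_iff_forall_notMem.2 fun t ht => hne ⟨t, ht⟩
  rw [tauPlus, this, Set.image_empty, sInf_empty]

theorem tauMinus_eq_bot {h : ℝ → EReal} {a : ℝ} {b : ℝ → ℝ}
    (hne : ¬ ∃ t, t ≤ a ∧ (b t : EReal) ≤ h t) : tauMinus h a b = ⊥ := by
  have : {t : ℝ | t ≤ a ∧ (b t : EReal) ≤ h t} = ∅ :=
    Set.eq_empty_iff_forall_notMem.2 fun t ht => hne ⟨t, ht⟩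
  rw [tauMinus, this, Set.image_empty, sSup_empty]

theorem weightBoth_eq_mul (h : ℝ → EReal) (η ξ : ℂ) (a : ℝ) (b : ℝ → ℝ) :
    weightBoth h η ξ a b = weightMinus h η a b * weightPlus h ξ a b := by
  unfold weightBoth weightMinus weightPlus
  by_cases h1 : tauPlus h a b < ⊤ <;> by_cases h2 : ⊥ < tauMinus h a b
  · rw [if_pos ⟨h1, h2⟩, if_pos h1, if_pos h2, ← Complex.exp_add]
    congr 1
    ring
  all_goals simp [h1, h2]

/-- If all hits lie in `(-∞, L]`, then `τ₊ ≤ L` is the same event as `τ₊ < ∞`. -/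
theorem weightPlusLe_eq_weightPlus {h : ℝ → EReal} (hh : UpperSemicontinuous h) (ξ : ℂ) {L : ℝ}
    (hL : ∀ x, L < x → h x = ⊥) (a : ℝ) {b : ℝ → ℝ} (hb : Continuous b) :
    weightPlusLe h ξ L a b = weightPlus h ξ a b := by
  unfold weightPlusLe weightPlus
  by_cases hne : ∃ t, a ≤ t ∧ (b t : EReal) ≤ h t
  · have hleast := isLeast_sInf_hit hh hb hne
    have hle : sInf {t : ℝ | a ≤ t ∧ (b t : EReal) ≤ h t} ≤ L := by
      by_contra hcon
      have := hleast.1.2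
      rw [hL _ (not_le.1 hcon), le_bot_iff] at this
      exact EReal.coe_ne_bot _ this
    rw [tauPlus_eq_coe hleast, if_pos (EReal.coe_le_coe_iff.2 hle), if_pos (EReal.coe_lt_top _)]
  · rw [tauPlus_eq_top hne, if_neg (by simp), if_neg (by simp)]

section Pathwise

variable {Ω : Type*} {W : ℝ → Ω → ℝ} {h : ℝ → EReal}

theorem continuous_pathFrom (hW : ∀ ω, Continuous fun t => W t ω) (a s : ℝ) (ω : Ω) :
    Continuous (pathFrom W a s ω) := by
  have := hW ω
  unfold pathFrom
  fun_prop

theorem weightPlus_pathFrom (hW : ∀ ω, Continuous fun t => W t ω) (hh : UpperSemicontinuous h)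
    (ξ : ℂ) (a s : ℝ) (ω : Ω) :
    weightPlus h ξ a (pathFrom W a s ω) =
      Complex.exp (-(a : ℂ) * ξ ^ 2) * stopWeight (fwd W a) (fun t => h (a + t)) ξ s ω := by
  have hcont : Continuous fun t => s + fwd W a t ω := by
    have := hW ω
    unfold fwd
    fun_prop
  have husc : UpperSemicontinuous fun t => h (a + t) := hh.comp (by fun_prop)
  unfold weightPlus stopWeight
  by_cases hne : ∃ r, 0 ≤ r ∧ ((s + fwd W a r ω : ℝ) : EReal) ≤ h (a + r)
  · have hl : IsLeast {r : ℝ | 0 ≤ r ∧ ((s + fwd W a r ω : ℝ) : EReal) ≤ h (a + r)}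
        (hitTime (fwd W a) (fun t => h (a + t)) s ω) := isLeast_sInf_hit husc hcont hne
    set σ := hitTime (fwd W a) (fun t => h (a + t)) s ω
    have hl' : IsLeast {t : ℝ | a ≤ t ∧ (pathFrom W a s ω t : EReal) ≤ h t} (a + σ) := by
      refine ⟨⟨by linarith [hl.1.1], hl.1.2⟩, fun t ht => ?_⟩
      have : σ ≤ t - a := hl.2 ⟨by linarith [ht.1], by
        simpa only [fwd, add_sub_cancel, pathFrom] using ht.2⟩
      linarith
    rw [tauPlus_eq_coe hl', if_pos (EReal.coe_lt_top _), if_pos hne, expMart, ← Complex.exp_add,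
      EReal.toReal_coe]
    congr 1
    simp only [pathFrom, fwd]
    push_cast
    ring
  · rw [tauPlus_eq_top, if_neg (by simp), if_neg hne, mul_zero]
    rintro ⟨t, ht, hle⟩
    exact hne ⟨t - a, by linarith, by simpa only [fwd, add_sub_cancel, pathFrom] using hle⟩

theorem weightMinus_pathFrom (hW : ∀ ω, Continuous fun t => W t ω) (hh : UpperSemicontinuous h)
    (η : ℂ) (a s : ℝ) (ω : Ω) :
    weightMinus h η a (pathFrom W a s ω) =
      Complex.exp ((a : ℂ) * η ^ 2) * stopWeight (bwd W a) (fun t => h (a - t)) (-η) s ω := by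
  have hcont : Continuous fun t => s + bwd W a t ω := by
    have := hW ω
    unfold bwd
    fun_prop
  have husc : UpperSemicontinuous fun t => h (a - t) := hh.comp (by fun_prop)
  unfold weightMinus stopWeight
  by_cases hne : ∃ r, 0 ≤ r ∧ ((s + bwd W a r ω : ℝ) : EReal) ≤ h (a - r)
  · have hl : IsLeast {r : ℝ | 0 ≤ r ∧ ((s + bwd W a r ω : ℝ) : EReal) ≤ h (a - r)}
        (hitTime (bwd W a) (fun t => h (a - t)) s ω) := isLeast_sInf_hit husc hcont hne
    set σ := hitTime (bwd W a) (fun t => h (a - t)) s ω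
    have hl' : IsGreatest {t : ℝ | t ≤ a ∧ (pathFrom W a s ω t : EReal) ≤ h t} (a - σ) := by
      refine ⟨⟨by linarith [hl.1.1], hl.1.2⟩, fun t ht => ?_⟩
      have : σ ≤ a - t := hl.2 ⟨by linarith [ht.1], by
        simpa only [bwd, sub_sub_cancel, pathFrom] using ht.2⟩
      linarith
    rw [tauMinus_eq_coe hl', if_pos (EReal.bot_lt_coe _), if_pos hne, expMart, ← Complex.exp_add,
      EReal.toReal_coe]
    congr 1
    simp only [pathFrom, bwd]
    push_cast
    ring
  · rw [tauMinus_eq_bot, if_neg (by simp), if_neg hne, mul_zero]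
    rintro ⟨t, ht, hle⟩
    exact hne ⟨a - t, by linarith, by simpa only [bwd, sub_sub_cancel, pathFrom] using hle⟩

/-- The joint exponential functional `exp (-T η² + B(-T) η) exp (-T ξ² - B(T) ξ)` of the path `B`
through `(0, s)`, as a function of `(ω, s)`. -/
noncomputable def endWeight (W : ℝ → Ω → ℝ) (T : ℝ) (η ξ : ℂ) (p : Ω × ℝ) : ℂ :=
  Complex.exp (-(T : ℂ) * η ^ 2 + ((p.2 + W (-T) p.1 : ℝ) : ℂ) * η) *
    Complex.exp (-(T : ℂ) * ξ ^ 2 - ((p.2 + W T p.1 : ℝ) : ℂ) * ξ)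

/-- The set of `(ω, s)` for which the path through `(0, s)` meets the hypograph of `h` during
`[c, d]`. -/
def hitOn (W : ℝ → Ω → ℝ) (h : ℝ → EReal) (c d : ℝ) : Set (Ω × ℝ) :=
  {p | ∃ r ∈ Set.Icc c d, ((p.2 + W r p.1 : ℝ) : EReal) ≤ h r}

/-- The change of coordinates from the value at time `a` to the value at time `0`. -/
def recenter (W : ℝ → Ω → ℝ) (a : ℝ) (p : Ω × ℝ) : Ω × ℝ := (p.1, p.2 - W a p.1)

theorem recenter_mem_hitOn_right {a T s : ℝ} {ω : Ω} :
    recenter W a (ω, s) ∈ hitOn W h a T ↔ ω ∈ hitBy (fwd W a) (fun t => h (a + t)) s (T - a) := by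
  constructor
  · rintro ⟨r, hr, hle⟩
    refine ⟨r - a, ⟨by linarith [hr.1], by linarith [hr.2]⟩, ?_⟩
    simp only [fwd, recenter, add_sub_cancel] at hle ⊢
    convert hle using 2
    ring
  · rintro ⟨r, hr, hle⟩
    refine ⟨a + r, ⟨by linarith [hr.1], by linarith [hr.2]⟩, ?_⟩
    simp only [fwd, recenter] at hle ⊢
    convert hle using 2
    ring

theorem recenter_mem_hitOn_left {a T s : ℝ} {ω : Ω} :
    recenter W a (ω, s) ∈ hitOn W h (-T) a ↔
      ω ∈ hitBy (bwd W a) (fun t => h (a - t)) s (T + a) := by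
  constructor
  · rintro ⟨r, hr, hle⟩
    refine ⟨a - r, ⟨by linarith [hr.2], by linarith [hr.1]⟩, ?_⟩
    simp only [bwd, recenter, sub_sub_cancel] at hle ⊢
    convert hle using 2
    ring
  · rintro ⟨r, hr, hle⟩
    refine ⟨a - r, ⟨by linarith [hr.2], by linarith [hr.1]⟩, ?_⟩
    simp only [bwd, recenter] at hle ⊢
    convert hle using 2
    ring

theorem endWeight_recenter (a T s : ℝ) (η ξ : ℂ) (ω : Ω) :
    endWeight W T η ξ (recenter W a (ω, s)) =
      (Complex.exp ((a : ℂ) * η ^ 2) * expMart (bwd W a) (-η) s (T + a) ω) *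
        (Complex.exp (-(a : ℂ) * ξ ^ 2) * expMart (fwd W a) ξ s (T - a) ω) := by
  simp only [endWeight, expMart, recenter, bwd, fwd, ← Complex.exp_add, add_sub_cancel,
    sub_add_cancel_right]
  congr 1
  push_cast
  ring

/-- Inclusion–exclusion for hits before and after time `a`. -/
theorem indicator_hitOn_split {a T : ℝ} (h1 : -T ≤ a) (h2 : a ≤ T) (f : Ω × ℝ → ℂ) (p : Ω × ℝ) :
    (hitOn W h (-T) T).indicator f p =
      (hitOn W h a T).indicator f p + (hitOn W h (-T) a).indicator f p -
        (hitOn W h (-T) a ∩ hitOn W h a T).indicator f p := by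
  have : hitOn W h (-T) T = hitOn W h a T ∪ hitOn W h (-T) a := by
    ext p
    constructor
    · rintro ⟨r, hr, hle⟩
      rcases le_total a r with har | har
      · exact Or.inl ⟨r, ⟨har, hr.2⟩, hle⟩
      · exact Or.inr ⟨r, ⟨hr.1, har⟩, hle⟩
    · rintro (⟨r, hr, hle⟩ | ⟨r, hr, hle⟩)
      · exact ⟨r, ⟨h1.trans hr.1, hr.2⟩, hle⟩
      · exact ⟨r, ⟨hr.1, hr.2.trans h2⟩, hle⟩
  rw [this, Set.inter_comm, eq_sub_iff_add_eq]
  exact congrFun (Set.indicator_union_add_inter f _ _) p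

end Pathwise

/-! ### Integrability under the law of the path times Lebesgue measure -/

section

variable {Ω : Type*} [MeasurableSpace Ω] {P : Measure Ω} {W : ℝ → Ω → ℝ} {h : ℝ → EReal}

/-- An upper semicontinuous function without the value `∞` that is `-∞` off a bounded interval is
bounded above by a real number. -/
theorem exists_real_bound (hh : UpperSemicontinuous h) (htop : ∀ x, h x ≠ ⊤) {T : ℝ}
    (hT : 0 ≤ T) (hbot : ∀ x : ℝ, T < |x| → h x = ⊥) : ∃ C : ℝ, ∀ x, h x ≤ C := by
  obtain ⟨x, -, hx⟩ := UpperSemicontinuousOn.exists_isMaxOn (s := Set.Icc (-T) T)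
    ⟨0, by linarith, hT⟩ isCompact_Icc (hh.upperSemicontinuousOn _)
  obtain ⟨C, hC1, -⟩ := EReal.lt_iff_exists_real_btwn.1 (lt_top_iff_ne_top.2 (htop x))
  refine ⟨C, fun y => ?_⟩
  by_cases hy : |y| ≤ T
  · exact (hx (abs_le.1 hy)).trans hC1.le
  · rw [hbot y (not_le.1 hy)]
    exact bot_le

namespace IsRegularTwoSidedBrownian

theorem exists_bound [IsProbabilityMeasure P] (hW : IsRegularTwoSidedBrownian W P) {T : ℝ}
    (hT : 0 ≤ T) :
    ∃ S : Ω → ℝ, Measurable S ∧ (∀ ω, ∀ r ∈ Set.Icc (-T) T, |W r ω| ≤ S ω) ∧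
      ∀ κ : ℝ, 0 ≤ κ → Integrable (fun ω => Real.exp (κ * S ω)) P := by
  obtain ⟨S₁, hm₁, hS₁, hi₁⟩ := (hW.isOneSidedBrownian_fwd 0).exists_bound hT
  obtain ⟨S₂, hm₂, hS₂, hi₂⟩ := (hW.isOneSidedBrownian_bwd 0).exists_bound hT
  refine ⟨fun ω => max (S₁ ω) (S₂ ω), hm₁.max hm₂, fun ω r hr => ?_, fun κ hκ => ?_⟩
  · rcases le_total 0 r with h0 | h0
    · have := hS₁ ω r ⟨h0, hr.2⟩
      simp only [fwd, zero_add, hW.zero, sub_zero] at this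
      exact this.trans (le_max_left _ _)
    · have := hS₂ ω (-r) ⟨by linarith, by linarith [hr.1]⟩
      simp only [bwd, zero_sub, neg_neg, hW.zero, sub_zero] at this
      exact this.trans (le_max_right _ _)
  · refine Integrable.mono' ((hi₁ κ hκ).add (hi₂ κ hκ)) (by fun_prop)
      (Filter.Eventually.of_forall fun ω => ?_)
    simp only [Real.norm_eq_abs, Real.abs_exp, Pi.add_apply]
    rcases max_cases (S₁ ω) (S₂ ω) with h | h <;> rw [h.1] <;>
      linarith [Real.exp_pos (κ * S₁ ω), Real.exp_pos (κ * S₂ ω)]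

theorem measurableSet_hitOn (hW : IsRegularTwoSidedBrownian W P) (hh : UpperSemicontinuous h)
    (c d : ℝ) : MeasurableSet (hitOn W h c d) :=
  measurableSet_hit hh (Y := fun r (p : Ω × ℝ) => p.2 + W r p.1)
    (fun r _ => measurable_snd.add ((hW.meas r).comp measurable_fst))
    fun p => continuous_const.add (hW.cont p.1)

theorem measurable_endWeight (hW : IsRegularTwoSidedBrownian W P) (T : ℝ) (η ξ : ℂ) :
    Measurable (endWeight W T η ξ) := by
  have h1 := hW.meas T
  have h2 := hW.meas (-T)
  unfold endWeight
  fun_prop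

/-- On the event of a hit, the starting point is at most the barrier plus the range of the path;
the end weight is therefore integrable there. -/
theorem integrable_indicator_endWeight [IsProbabilityMeasure P]
    (hW : IsRegularTwoSidedBrownian W P) {C : ℝ} (hC : ∀ x, h x ≤ C) {η ξ : ℂ} (hη : 0 < η.re) (hξ : ξ.re < 0) {T : ℝ} (hT : 0 ≤ T)
    {A : Set (Ω × ℝ)} (hA : MeasurableSet A) (hAT : A ⊆ hitOn W h (-T) T) :
    Integrable (A.indicator (endWeight W T η ξ)) (P.prod volume) := by
  obtain ⟨S, hSm, hS, hexp⟩ := hW.exists_bound hT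
  let κ := η.re - ξ.re
  have hκ : 0 < κ := by
    simp only [κ]
    linarith
  let K := T * (‖η‖ ^ 2 + ‖ξ‖ ^ 2)
  let G : Ω × ℝ → ℝ := fun p => {p : Ω × ℝ | p.2 ≤ C + S p.1}.indicator
    (fun p => Real.exp (K + κ * S p.1) * Real.exp (κ * p.2)) p
  have hset : MeasurableSet {p : Ω × ℝ | p.2 ≤ C + S p.1} :=
    measurableSet_le measurable_snd (by fun_prop)
  have hGm : Measurable G := Measurable.indicator (by fun_prop) hset
  have hslice : ∀ ω, (fun s => G (ω, s)) = (Set.Iic (C + S ω)).indicator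
      (fun s => Real.exp (K + κ * S ω) * Real.exp (κ * s)) := by
    intro ω
    ext s
    by_cases hs : s ≤ C + S ω
    · rw [Set.indicator_of_mem (show s ∈ Set.Iic (C + S ω) from hs)]
      exact Set.indicator_of_mem (show (ω, s) ∈ {p : Ω × ℝ | p.2 ≤ C + S p.1} from hs) _
    · rw [Set.indicator_of_notMem (show s ∉ Set.Iic (C + S ω) from hs)]
      exact Set.indicator_of_notMem (show (ω, s) ∉ {p : Ω × ℝ | p.2 ≤ C + S p.1} from hs) _
  have hG0 : ∀ p, 0 ≤ G p := fun p => Set.indicator_nonneg (fun _ _ => by positivity) _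
  -- Integrating `exp (κ s)` over `s ≤ C + S` produces a second factor `exp (κ S)`.
  have hG : Integrable G (P.prod volume) := by
    rw [integrable_prod_iff hGm.aestronglyMeasurable]
    constructor
    · refine Filter.Eventually.of_forall fun ω => ?_
      rw [hslice, integrable_indicator_iff measurableSet_Iic]
      exact (integrableOn_exp_mul_Iic hκ _).const_mul _
    · have : (fun ω => ∫ s, ‖G (ω, s)‖) =
          fun ω => Real.exp (K + κ * C) / κ * Real.exp (2 * κ * S ω) := by
        ext ω
        simp_rw [Real.norm_of_nonneg (hG0 _)]
        rw [hslice, integral_indicator measurableSet_Iic, integral_const_mul,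
          integral_exp_mul_Iic hκ, ← mul_div_assoc, ← Real.exp_add, div_mul_eq_mul_div,
          ← Real.exp_add]
        congr 2
        ring
      rw [this]
      exact (hexp _ (by positivity)).const_mul _
  refine Integrable.mono' hG
    ((hW.measurable_endWeight T η ξ).indicator hA).aestronglyMeasurable
    (Filter.Eventually.of_forall fun p => ?_)
  by_cases hp : p ∈ A
  · obtain ⟨r, hr, hle⟩ := hAT hp
    have hle' : p.2 + W r p.1 ≤ C := EReal.coe_le_coe_iff.1 (hle.trans (hC r))
    have hp2 : p.2 ≤ C + S p.1 := by
      have := neg_le_of_abs_le (hS p.1 r hr)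
      linarith
    have hGp : G p = Real.exp (K + κ * S p.1) * Real.exp (κ * p.2) :=
      Set.indicator_of_mem (show p ∈ {p : Ω × ℝ | p.2 ≤ C + S p.1} from hp2) _
    rw [Set.indicator_of_mem hp, hGp, endWeight, norm_mul, Complex.norm_exp, Complex.norm_exp,
      ← Real.exp_add, ← Real.exp_add]
    apply Real.exp_le_exp.2
    have e1 : (-(T : ℂ) * η ^ 2 + ((p.2 + W (-T) p.1 : ℝ) : ℂ) * η).re =
        -T * (η ^ 2).re + (p.2 + W (-T) p.1) * η.re := by
      rw [Complex.add_re, Complex.re_ofReal_mul, ← Complex.ofReal_neg, Complex.re_ofReal_mul]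
    have e2 : (-(T : ℂ) * ξ ^ 2 - ((p.2 + W T p.1 : ℝ) : ℂ) * ξ).re =
        -T * (ξ ^ 2).re - (p.2 + W T p.1) * ξ.re := by
      rw [Complex.sub_re, Complex.re_ofReal_mul, ← Complex.ofReal_neg, Complex.re_ofReal_mul]
    have b1 : -(‖η‖ ^ 2) ≤ (η ^ 2).re := by
      have := neg_le_of_abs_le (Complex.abs_re_le_norm (η ^ 2))
      rwa [norm_pow] at this
    have b2 : -(‖ξ‖ ^ 2) ≤ (ξ ^ 2).re := by
      have := neg_le_of_abs_le (Complex.abs_re_le_norm (ξ ^ 2))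
      rwa [norm_pow] at this
    have c1 := mul_le_mul_of_nonneg_left b1 hT
    have c2 := mul_le_mul_of_nonneg_left b2 hT
    have d1 : W (-T) p.1 * η.re ≤ S p.1 * η.re :=
      mul_le_mul_of_nonneg_right
        (le_of_abs_le (hS p.1 (-T) ⟨le_rfl, by linarith⟩)) hη.le
    have d2 : W T p.1 * (-ξ.re) ≤ S p.1 * (-ξ.re) :=
      mul_le_mul_of_nonneg_right
        (le_of_abs_le (hS p.1 T ⟨by linarith, le_rfl⟩)) (by linarith)
    rw [e1, e2]
    simp only [K, κ]
    linarith
  · rw [Set.indicator_of_notMem hp, norm_zero]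
    exact hG0 p

/-- Lebesgue measure for the value at time `a` is the same as for the value at time `0`. -/
theorem measurePreserving_recenter [IsProbabilityMeasure P] (hW : IsRegularTwoSidedBrownian W P)
    (a : ℝ) : MeasurePreserving (recenter W a) (P.prod volume) (P.prod volume) := by
  have hm := hW.meas a
  refine (MeasurePreserving.id P).skew_product (g := fun ω s => s - W a ω) ?_
    (Filter.Eventually.of_forall fun ω => ?_)
  · unfold Function.uncurry
    fun_prop
  · exact (measurePreserving_sub_right volume (W a ω)).map_eq

end IsRegularTwoSidedBrownian

end

/-! ### The three terms as integrals of the end weight -/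

section

variable {Ω : Type*} [MeasurableSpace Ω] {P : Measure Ω} {W : ℝ → Ω → ℝ} {h : ℝ → EReal}

namespace IsRegularTwoSidedBrownian

theorem integral_mul_past_future [IsProbabilityMeasure P] (hW : IsRegularTwoSidedBrownian W P)
    {a : ℝ} {f g : Ω → ℂ} (hf : Measurable[pastSigma W a] f) (hg : Measurable[futureSigma W a] g) :
    ∫ ω, f ω * g ω ∂P = (∫ ω, f ω ∂P) * ∫ ω, g ω ∂P := by
  have hind : IndepFun f g P := by
    rw [IndepFun_iff_Indep]
    exact indep_of_indep_of_le_left (indep_of_indep_of_le_right (hW.indep_past_future a)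
      hg.comap_le) hf.comap_le
  exact hind.integral_fun_mul_eq_mul_integral
    (hf.mono (hW.pastSigma_le a) le_rfl).aestronglyMeasurable
    (hg.mono (hW.futureSigma_le a) le_rfl).aestronglyMeasurable

/-- The weight of the first hit after `a` depends on the future of `a` only, and optional stopping
expresses its expectation through the exponential martingale at time `T`. -/
theorem weightPlus_expectation [IsProbabilityMeasure P] (hW : IsRegularTwoSidedBrownian W P)
    (hh : UpperSemicontinuous h) {a T : ℝ} (haT : a < T) (hbot : ∀ x, T < |x| → h x = ⊥)
    (ξ : ℂ) (s : ℝ) :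
    Measurable[futureSigma W a] (fun ω => weightPlus h ξ a (pathFrom W a s ω)) ∧
      Integrable (fun ω => weightPlus h ξ a (pathFrom W a s ω)) P ∧
      expFrom W P a s (weightPlus h ξ a) =
        ∫ ω, (hitBy (fwd W a) (fun t => h (a + t)) s (T - a)).indicator
          (fun ω => Complex.exp (-(a : ℂ) * ξ ^ 2) * expMart (fwd W a) ξ s (T - a) ω) ω ∂P := by
  have hX := hW.isOneSidedBrownian_fwd a
  have husc : UpperSemicontinuous fun t => h (a + t) := hh.comp (by fun_prop)
  have hgu : ∀ t, T - a < t → h (a + t) = ⊥ := fun t ht =>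
    hbot _ ((by linarith : T < a + t).trans_le (le_abs_self _))
  obtain ⟨h1, h2⟩ :=
    hX.integrable_stopWeight_and_integral_eq husc (sub_pos.2 haT) hgu ξ s
  have h3 := measurable_stopWeight hX.cont husc (sub_pos.2 haT) hgu ξ s
    (fun r hr => measurable_fwd_futureSigma W a hr.1)
  unfold expFrom
  simp_rw [weightPlus_pathFrom hW.cont hh, Set.indicator_const_mul]
  refine ⟨h3.const_mul _, h1.const_mul _, ?_⟩
  rw [integral_const_mul, integral_const_mul, h2]

/-- The mirror image of `weightPlus_expectation`: the last hit before `a` is a first hit of the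
time-reversed path, and `η` turns into `-η`. -/
theorem weightMinus_expectation [IsProbabilityMeasure P] (hW : IsRegularTwoSidedBrownian W P)
    (hh : UpperSemicontinuous h) {a T : ℝ} (haT : -T < a) (hbot : ∀ x, T < |x| → h x = ⊥)
    (η : ℂ) (s : ℝ) :
    Measurable[pastSigma W a] (fun ω => weightMinus h η a (pathFrom W a s ω)) ∧
      Integrable (fun ω => weightMinus h η a (pathFrom W a s ω)) P ∧
      expFrom W P a s (weightMinus h η a) =
        ∫ ω, (hitBy (bwd W a) (fun t => h (a - t)) s (T + a)).indicator
          (fun ω => Complex.exp ((a : ℂ) * η ^ 2) * expMart (bwd W a) (-η) s (T + a) ω) ω ∂P := by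
  have hX := hW.isOneSidedBrownian_bwd a
  have husc : UpperSemicontinuous fun t => h (a - t) := hh.comp (by fun_prop)
  have hu : 0 < T + a := by linarith
  have hgu : ∀ t, T + a < t → h (a - t) = ⊥ := fun t ht =>
    hbot _ ((by linarith : T < -(a - t)).trans_le (neg_le_abs _))
  obtain ⟨h1, h2⟩ := hX.integrable_stopWeight_and_integral_eq husc hu hgu (-η) s
  have h3 := measurable_stopWeight hX.cont husc hu hgu (-η) s
    (fun r hr => measurable_bwd_pastSigma W a hr.1)
  unfold expFrom
  simp_rw [weightMinus_pathFrom hW.cont hh, Set.indicator_const_mul]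
  refine ⟨h3.const_mul _, h1.const_mul _, ?_⟩
  rw [integral_const_mul, integral_const_mul, h2]

/-- The expectation of the two-sided weight factorizes, because the two weights depend on the past
and on the future of `a` respectively. -/
theorem weightBoth_expectation [IsProbabilityMeasure P] (hW : IsRegularTwoSidedBrownian W P)
    (hh : UpperSemicontinuous h) {a T : ℝ} (haT : a < T) (haT' : -T < a)
    (hbot : ∀ x, T < |x| → h x = ⊥) (η ξ : ℂ) (s : ℝ) :
    Integrable (fun ω => weightBoth h η ξ a (pathFrom W a s ω)) P ∧
      expFrom W P a s (weightBoth h η ξ a) =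
        expFrom W P a s (weightMinus h η a) * expFrom W P a s (weightPlus h ξ a) := by
  obtain ⟨p1, p2, -⟩ := hW.weightPlus_expectation hh haT hbot ξ s
  obtain ⟨m1, m2, -⟩ := hW.weightMinus_expectation hh haT' hbot η s
  unfold expFrom
  simp_rw [weightBoth_eq_mul]
  refine ⟨IndepFun.integrable_mul ?_ m2 p2, hW.integral_mul_past_future m1 p1⟩
  rw [IndepFun_iff_Indep]
  exact indep_of_indep_of_le_left (indep_of_indep_of_le_right (hW.indep_past_future a)
    p1.comap_le) m1.comap_le

theorem measurableSet_hitBy_fwd (hW : IsRegularTwoSidedBrownian W P) [IsProbabilityMeasure P]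
    (hh : UpperSemicontinuous h) (a s u : ℝ) :
    MeasurableSet[futureSigma W a] (hitBy (fwd W a) (fun t => h (a + t)) s u) :=
  measurableSet_hitBy (hW.isOneSidedBrownian_fwd a).cont (hh.comp (by fun_prop)) s
    fun r hr => measurable_fwd_futureSigma W a hr.1

theorem measurableSet_hitBy_bwd (hW : IsRegularTwoSidedBrownian W P) [IsProbabilityMeasure P]
    (hh : UpperSemicontinuous h) (a s u : ℝ) :
    MeasurableSet[pastSigma W a] (hitBy (bwd W a) (fun t => h (a - t)) s u) :=
  measurableSet_hitBy (hW.isOneSidedBrownian_bwd a).cont (hh.comp (by fun_prop)) s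
    fun r hr => measurable_bwd_pastSigma W a hr.1

/-- The first term: given the future of `a`, the end weight at `-T` averages to its value at `a`. -/
theorem integral_hitOn_right [IsProbabilityMeasure P] (hW : IsRegularTwoSidedBrownian W P)
    (hh : UpperSemicontinuous h) {a T : ℝ} (haT : a < T) (haT' : -T < a)
    (hbot : ∀ x, T < |x| → h x = ⊥) (η ξ : ℂ) (s : ℝ) :
    ∫ ω, (hitOn W h a T).indicator (endWeight W T η ξ) (recenter W a (ω, s)) ∂P =
      Complex.exp ((a : ℂ) * η ^ 2) *
        (Complex.exp ((s : ℂ) * η) * expFrom W P a s (weightPlus h ξ a)) := by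
  have hpt : ∀ ω, (hitOn W h a T).indicator (endWeight W T η ξ) (recenter W a (ω, s)) =
      (Complex.exp ((a : ℂ) * η ^ 2) * expMart (bwd W a) (-η) s (T + a) ω) *
        (hitBy (fwd W a) (fun t => h (a + t)) s (T - a)).indicator
          (fun ω => Complex.exp (-(a : ℂ) * ξ ^ 2) * expMart (fwd W a) ξ s (T - a) ω) ω := by
    intro ω
    by_cases hω : recenter W a (ω, s) ∈ hitOn W h a T
    · rw [Set.indicator_of_mem hω, Set.indicator_of_mem (recenter_mem_hitOn_right.1 hω),
        endWeight_recenter]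
    · rw [Set.indicator_of_notMem hω,
        Set.indicator_of_notMem (fun h' => hω (recenter_mem_hitOn_right.2 h')), mul_zero]
  simp_rw [hpt]
  rw [hW.integral_mul_past_future
      ((measurable_expMart_bwd W (by linarith) (-η) s).const_mul _)
      (((measurable_expMart_fwd W (by linarith) ξ s).const_mul _).indicator
        (hW.measurableSet_hitBy_fwd hh a s _)),
    ← (hW.weightPlus_expectation hh haT hbot ξ s).2.2, integral_const_mul,
    (hW.isOneSidedBrownian_bwd a).integral_expMart (-η) s (by linarith), neg_mul_neg, mul_assoc]

/-- The second term: given the past of `a`, the end weight at `T` averages to its value at `a`. -/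
theorem integral_hitOn_left [IsProbabilityMeasure P] (hW : IsRegularTwoSidedBrownian W P)
    (hh : UpperSemicontinuous h) {a T : ℝ} (haT : a < T) (haT' : -T < a)
    (hbot : ∀ x, T < |x| → h x = ⊥) (η ξ : ℂ) (s : ℝ) :
    ∫ ω, (hitOn W h (-T) a).indicator (endWeight W T η ξ) (recenter W a (ω, s)) ∂P =
      Complex.exp (-(a : ℂ) * ξ ^ 2) *
        (Complex.exp (-(s : ℂ) * ξ) * expFrom W P a s (weightMinus h η a)) := by
  have hpt : ∀ ω, (hitOn W h (-T) a).indicator (endWeight W T η ξ) (recenter W a (ω, s)) =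
      (hitBy (bwd W a) (fun t => h (a - t)) s (T + a)).indicator
          (fun ω => Complex.exp ((a : ℂ) * η ^ 2) * expMart (bwd W a) (-η) s (T + a) ω) ω *
        (Complex.exp (-(a : ℂ) * ξ ^ 2) * expMart (fwd W a) ξ s (T - a) ω) := by
    intro ω
    by_cases hω : recenter W a (ω, s) ∈ hitOn W h (-T) a
    · rw [Set.indicator_of_mem hω, Set.indicator_of_mem (recenter_mem_hitOn_left.1 hω),
        endWeight_recenter]
    · rw [Set.indicator_of_notMem hω,
        Set.indicator_of_notMem (fun h' => hω (recenter_mem_hitOn_left.2 h')), zero_mul]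
  simp_rw [hpt]
  rw [hW.integral_mul_past_future
      (((measurable_expMart_bwd W (by linarith) (-η) s).const_mul _).indicator
        (hW.measurableSet_hitBy_bwd hh a s _))
      ((measurable_expMart_fwd W (by linarith) ξ s).const_mul _),
    ← (hW.weightMinus_expectation hh haT' hbot η s).2.2, integral_const_mul,
    (hW.isOneSidedBrownian_fwd a).integral_expMart ξ s (by linarith), mul_comm, mul_assoc]

/-- The third term: the end weights on both sides are stopped independently. -/
theorem integral_hitOn_inter [IsProbabilityMeasure P] (hW : IsRegularTwoSidedBrownian W P)
    (hh : UpperSemicontinuous h) {a T : ℝ} (haT : a < T) (haT' : -T < a)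
    (hbot : ∀ x, T < |x| → h x = ⊥) (η ξ : ℂ) (s : ℝ) :
    ∫ ω, (hitOn W h (-T) a ∩ hitOn W h a T).indicator (endWeight W T η ξ)
        (recenter W a (ω, s)) ∂P = expFrom W P a s (weightBoth h η ξ a) := by
  have hpt : ∀ ω, (hitOn W h (-T) a ∩ hitOn W h a T).indicator (endWeight W T η ξ)
        (recenter W a (ω, s)) =
      (hitBy (bwd W a) (fun t => h (a - t)) s (T + a)).indicator
          (fun ω => Complex.exp ((a : ℂ) * η ^ 2) * expMart (bwd W a) (-η) s (T + a) ω) ω *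
        (hitBy (fwd W a) (fun t => h (a + t)) s (T - a)).indicator
          (fun ω => Complex.exp (-(a : ℂ) * ξ ^ 2) * expMart (fwd W a) ξ s (T - a) ω) ω := by
    intro ω
    by_cases h1 : recenter W a (ω, s) ∈ hitOn W h (-T) a
    · by_cases h2 : recenter W a (ω, s) ∈ hitOn W h a T
      · rw [Set.indicator_of_mem (Set.mem_inter h1 h2), Set.indicator_of_mem (recenter_mem_hitOn_left.1 h1),
          Set.indicator_of_mem (recenter_mem_hitOn_right.1 h2), endWeight_recenter]
      · rw [Set.indicator_of_notMem fun h' => h2 (Set.mem_of_mem_inter_right h'),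
          Set.indicator_of_notMem (s := hitBy (fwd W a) _ _ _)
            (fun h' => h2 (recenter_mem_hitOn_right.2 h')), mul_zero]
    · rw [Set.indicator_of_notMem fun h' => h1 (Set.mem_of_mem_inter_left h'),
        Set.indicator_of_notMem (fun h' => h1 (recenter_mem_hitOn_left.2 h')), zero_mul]
  simp_rw [hpt]
  rw [hW.integral_mul_past_future
      (((measurable_expMart_bwd W (by linarith) (-η) s).const_mul _).indicator
        (hW.measurableSet_hitBy_bwd hh a s _))
      (((measurable_expMart_fwd W (by linarith) ξ s).const_mul _).indicator
        (hW.measurableSet_hitBy_fwd hh a s _)),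
    ← (hW.weightMinus_expectation hh haT' hbot η s).2.2,
    ← (hW.weightPlus_expectation hh haT hbot ξ s).2.2,
    (hW.weightBoth_expectation hh haT haT' hbot η ξ s).2]

/-- Under Lebesgue measure for the starting value, the law of the two-sided path does not depend on
the time `a` at which the value is prescribed. -/
theorem integral_recenter [IsProbabilityMeasure P] (hW : IsRegularTwoSidedBrownian W P) (a : ℝ)
    {f : Ω × ℝ → ℂ} (hf : Integrable f (P.prod volume)) :
    Integrable (fun s => ∫ ω, f (recenter W a (ω, s)) ∂P) ∧
      ∫ s, ∫ ω, f (recenter W a (ω, s)) ∂P = ∫ p, f p ∂(P.prod volume) := by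
  have hmp := hW.measurePreserving_recenter a
  have hint : Integrable (fun p => f (recenter W a p)) (P.prod volume) :=
    (hmp.integrable_comp hf.aestronglyMeasurable).2 hf
  refine ⟨hint.integral_prod_right, ?_⟩
  rw [← integral_prod_symm _ hint]
  nth_rewrite 2 [← hmp.map_eq]
  rw [integral_map hmp.aemeasurable (by rw [hmp.map_eq]; exact hf.aestronglyMeasurable)]

/-- The three terms at `a` add up, by inclusion–exclusion, to the integral of the end weight over
the event of a hit, which does not involve `a`. -/
theorem chi_terms_eq [IsProbabilityMeasure P] (hW : IsRegularTwoSidedBrownian W P)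
    (hh : UpperSemicontinuous h) (htop : ∀ x, h x ≠ ⊤) {a T : ℝ} (haT : a < T) (haT' : -T < a)
    (hbot : ∀ x, T < |x| → h x = ⊥) {η ξ : ℂ} (hη : 0 < η.re) (hξ : ξ.re < 0) :
    Integrable (fun s : ℝ => Complex.exp ((s : ℂ) * η) * expFrom W P a s (weightPlus h ξ a)) ∧
    Integrable (fun s : ℝ => Complex.exp (-(s : ℂ) * ξ) * expFrom W P a s (weightMinus h η a)) ∧
    Integrable (fun s : ℝ => expFrom W P a s (weightBoth h η ξ a)) ∧
    Complex.exp ((a : ℂ) * η ^ 2) *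
          (∫ s : ℝ, Complex.exp ((s : ℂ) * η) * expFrom W P a s (weightPlus h ξ a))
        + Complex.exp (-(a : ℂ) * ξ ^ 2) *
          (∫ s : ℝ, Complex.exp (-(s : ℂ) * ξ) * expFrom W P a s (weightMinus h η a))
        - ∫ s : ℝ, expFrom W P a s (weightBoth h η ξ a) =
      ∫ p, (hitOn W h (-T) T).indicator (endWeight W T η ξ) p ∂(P.prod volume) := by
  have hT : 0 ≤ T := by linarith
  obtain ⟨C, hC⟩ := exists_real_bound hh htop hT hbot
  have hsub1 : hitOn W h a T ⊆ hitOn W h (-T) T := fun p ⟨r, hr, hle⟩ =>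
    ⟨r, ⟨haT'.le.trans hr.1, hr.2⟩, hle⟩
  have hsub2 : hitOn W h (-T) a ⊆ hitOn W h (-T) T := fun p ⟨r, hr, hle⟩ =>
    ⟨r, ⟨hr.1, hr.2.trans haT.le⟩, hle⟩
  have hm1 := hW.measurableSet_hitOn hh a T
  have hm2 := hW.measurableSet_hitOn hh (-T) a
  have i1 := hW.integrable_indicator_endWeight hC hη hξ hT hm1 hsub1
  have i2 := hW.integrable_indicator_endWeight hC hη hξ hT hm2 hsub2
  have i3 := hW.integrable_indicator_endWeight hC hη hξ hT (hm2.inter hm1)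
    (Set.inter_subset_left.trans hsub2)
  obtain ⟨j1, e1⟩ := hW.integral_recenter a i1
  obtain ⟨j2, e2⟩ := hW.integral_recenter a i2
  obtain ⟨j3, e3⟩ := hW.integral_recenter a i3
  simp_rw [hW.integral_hitOn_right hh haT haT' hbot] at j1 e1
  simp_rw [hW.integral_hitOn_left hh haT haT' hbot] at j2 e2
  simp_rw [hW.integral_hitOn_inter hh haT haT' hbot] at j3 e3
  rw [integral_const_mul] at e1 e2
  refine ⟨?_, ?_, j3, ?_⟩
  · exact (integrable_const_mul_iff (Complex.exp_ne_zero _).isUnit _).1 j1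
  · exact (integrable_const_mul_iff (Complex.exp_ne_zero _).isUnit _).1 j2
  · rw [e1, e2, e3]
    simp_rw [indicator_hitOn_split haT'.le haT.le]
    have h12 := integral_sub (i1.add i2) i3
    simp only [Pi.add_apply] at h12
    rw [h12, integral_add i1 i2]

/-- If the barrier is `-∞` before `a`, then the first term alone is the integral of the end
weight over the event of a hit. -/
theorem first_term_eq [IsProbabilityMeasure P] (hW : IsRegularTwoSidedBrownian W P)
    (hh : UpperSemicontinuous h) (htop : ∀ x, h x ≠ ⊤) {a T : ℝ} (haT : a < T) (haT' : -T < a)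
    (hbot : ∀ x, T < |x| → h x = ⊥) (hbot' : ∀ x, x < a → h x = ⊥)
    {η ξ : ℂ} (hη : 0 < η.re) (hξ : ξ.re < 0) :
    Complex.exp ((a : ℂ) * η ^ 2) *
        (∫ s : ℝ, Complex.exp ((s : ℂ) * η) * expFrom W P a s (weightPlus h ξ a)) =
      ∫ p, (hitOn W h (-T) T).indicator (endWeight W T η ξ) p ∂(P.prod volume) := by
  have hT : 0 ≤ T := by linarith
  obtain ⟨C, hC⟩ := exists_real_bound hh htop hT hbot
  have heq : hitOn W h (-T) T = hitOn W h a T := by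
    ext p
    constructor
    · rintro ⟨r, hr, hle⟩
      refine ⟨r, ⟨?_, hr.2⟩, hle⟩
      by_contra hcon
      rw [hbot' r (not_le.1 hcon), le_bot_iff] at hle
      exact EReal.coe_ne_bot _ hle
    · rintro ⟨r, hr, hle⟩
      exact ⟨r, ⟨haT'.le.trans hr.1, hr.2⟩, hle⟩
  have e1 := (hW.integral_recenter a (hW.integrable_indicator_endWeight hC hη hξ hT
    (hW.measurableSet_hitOn hh a T) heq.ge)).2
  simp_rw [hW.integral_hitOn_right hh haT haT' hbot] at e1
  rw [heq, ← e1, integral_const_mul]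

end IsRegularTwoSidedBrownian

theorem expFrom_congr {V : ℝ → Ω → ℝ} (hVW : ∀ᵐ ω ∂P, ∀ t, V t ω = W t ω) (a s : ℝ)
    (F : (ℝ → ℝ) → ℂ) : expFrom W P a s F = expFrom V P a s F := by
  refine integral_congr_ae ?_
  filter_upwards [hVW] with ω hω
  congr 1
  ext t
  simp only [pathFrom, hω]

theorem integrable_pathFrom_congr {V : ℝ → Ω → ℝ} (hVW : ∀ᵐ ω ∂P, ∀ t, V t ω = W t ω) {a s : ℝ}
    {F : (ℝ → ℝ) → ℂ} (hF : Integrable (fun ω => F (pathFrom V a s ω)) P) :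
    Integrable (fun ω => F (pathFrom W a s ω)) P := by
  refine hF.congr ?_
  filter_upwards [hVW] with ω hω
  congr 1
  ext t
  simp only [pathFrom, hω]

end

theorem proposition2p3 {Ω : Type*} [MeasurableSpace Ω] (P : Measure Ω) [IsProbabilityMeasure P]
    (W : ℝ → Ω → ℝ) (hW : IsTwoSidedBrownian W P)
    (h : ℝ → EReal) (hh : h ∈ UCc) (η ξ : ℂ) (hη : 0 < η.re) (hξ : ξ.re < 0) :
    (∀ a : ℝ,
      -- the expectations and integrals below converge absolutely
      ((∀ s : ℝ, Integrable (fun ω => weightPlus h ξ a (pathFrom W a s ω)) P ∧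
          Integrable (fun ω => weightMinus h η a (pathFrom W a s ω)) P ∧
          Integrable (fun ω => weightBoth h η ξ a (pathFrom W a s ω)) P) ∧
        Integrable (fun s : ℝ =>
          Complex.exp ((s : ℂ) * η) * expFrom W P a s (weightPlus h ξ a)) ∧
        Integrable (fun s : ℝ =>
          Complex.exp (-(s : ℂ) * ξ) * expFrom W P a s (weightMinus h η a)) ∧
        Integrable (fun s : ℝ => expFrom W P a s (weightBoth h η ξ a))) ∧
      chi W P h η ξ =
        Complex.exp ((a : ℂ) * η ^ 2) *
            (∫ s : ℝ, Complex.exp ((s : ℂ) * η) * expFrom W P a s (weightPlus h ξ a))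
          + Complex.exp (-(a : ℂ) * ξ ^ 2) *
            (∫ s : ℝ, Complex.exp (-(s : ℂ) * ξ) * expFrom W P a s (weightMinus h η a))
          - ∫ s : ℝ, expFrom W P a s (weightBoth h η ξ a)) ∧
    (∀ L : ℝ, 0 < L → hSupport h ⊆ Set.Icc (-L) L →
      ((∀ s : ℝ, Integrable (fun ω => weightPlusLe h ξ L (-L) (pathFrom W (-L) s ω)) P) ∧
        Integrable (fun s : ℝ =>
          Complex.exp ((s : ℂ) * η) * expFrom W P (-L) s (weightPlusLe h ξ L (-L)))) ∧
      chi W P h η ξ =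
        Complex.exp (-(L : ℂ) * η ^ 2) *
          ∫ s : ℝ, Complex.exp ((s : ℂ) * η) *
            expFrom W P (-L) s (weightPlusLe h ξ L (-L))) := by

  obtain ⟨V, hV, hVW⟩ := hW.exists_regular
  obtain ⟨⟨hh, htop, -, -, -⟩, L₀, hL₀, hL₀bot⟩ := hh
  have hE := fun a s F => expFrom_congr hVW a s F
  have hwt : ∀ a s : ℝ, Integrable (fun ω => weightPlus h ξ a (pathFrom W a s ω)) P ∧
      Integrable (fun ω => weightMinus h η a (pathFrom W a s ω)) P ∧
      Integrable (fun ω => weightBoth h η ξ a (pathFrom W a s ω)) P := by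
    intro a s
    have haT : a < |a| + L₀ := by linarith [le_abs_self a]
    have haT' : -(|a| + L₀) < a := by linarith [neg_abs_le a]
    have hbot : ∀ x : ℝ, |a| + L₀ < |x| → h x = ⊥ := fun x hx =>
      hL₀bot x (by linarith [abs_nonneg a])
    exact ⟨integrable_pathFrom_congr hVW (hV.weightPlus_expectation hh haT hbot ξ s).2.1,
      integrable_pathFrom_congr hVW (hV.weightMinus_expectation hh haT' hbot η s).2.1,
      integrable_pathFrom_congr hVW (hV.weightBoth_expectation hh haT haT' hbot η ξ s).1⟩
  -- `chi` is the sum of the three terms at `a = 0`, since the two sides of `0` are independent.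
  have hchi : ∀ T : ℝ, 0 < T → (∀ x : ℝ, T < |x| → h x = ⊥) → chi W P h η ξ =
      ∫ p, (hitOn V h (-T) T).indicator (endWeight V T η ξ) p ∂(P.prod volume) := by
    intro T hT hbot
    have hT' : -T < 0 := by linarith
    rw [← (hV.chi_terms_eq hh htop hT hT' hbot hη hξ).2.2.2]
    unfold chi
    simp_rw [hE, (hV.weightBoth_expectation hh hT hT' hbot η ξ _).2]
    simp [mul_comm]
  refine ⟨fun a => ?_, fun L hL hsupp => ?_⟩
  · have haT : a < |a| + L₀ := by linarith [le_abs_self a]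
    have haT' : -(|a| + L₀) < a := by linarith [neg_abs_le a]
    have hbot : ∀ x : ℝ, |a| + L₀ < |x| → h x = ⊥ := fun x hx =>
      hL₀bot x (by linarith [abs_nonneg a])
    obtain ⟨j1, j2, j3, e⟩ := hV.chi_terms_eq hh htop haT haT' hbot hη hξ
    rw [hchi (|a| + L₀) (by positivity) hbot]
    simp_rw [hE]
    exact ⟨⟨hwt a, j1, j2, j3⟩, e.symm⟩
  · have hout : ∀ x : ℝ, x ∉ Set.Icc (-L) L → h x = ⊥ := by
      intro x hx
      by_contra hne
      exact hx (hsupp (subset_closure hne))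
    have hbot : ∀ x : ℝ, L + 1 < |x| → h x = ⊥ := fun x hx =>
      hout x fun hmem => by linarith [abs_le.2 hmem]
    have hle : ∀ s ω, weightPlusLe h ξ L (-L) (pathFrom V (-L) s ω) =
        weightPlus h ξ (-L) (pathFrom V (-L) s ω) := fun s ω =>
      weightPlusLe_eq_weightPlus hh ξ (fun x hx => hout x fun hmem => by linarith [hmem.2]) (-L)
        (continuous_pathFrom hV.cont _ _ _)
    have hEle : ∀ s, expFrom W P (-L) s (weightPlusLe h ξ L (-L)) =
        expFrom V P (-L) s (weightPlus h ξ (-L)) := by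
      intro s
      rw [hE]
      unfold expFrom
      simp_rw [hle]
    have haT : -L < L + 1 := by linarith
    have haT' : -(L + 1) < -L := by linarith
    simp_rw [hEle]
    refine ⟨⟨fun s => integrable_pathFrom_congr hVW ?_,
      (hV.chi_terms_eq hh htop haT haT' hbot hη hξ).1⟩, ?_⟩
    · simp_rw [hle]
      exact (hV.weightPlus_expectation hh haT hbot ξ s).2.1
    · rw [hchi (L + 1) (by linarith) hbot, ← hV.first_term_eq hh htop haT haT' hbot
        (fun x hx => hout x fun hmem => by linarith [hmem.1]) hη hξ, Complex.ofReal_neg]
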